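/- **Setting.** Let $\mathcal E$ be an NQ symplectic manifold of degree 2 with a generalized metric (a symplectic involution $\iota$ over the identity of the base $\mathcal E_0$), described in adapted local coordinates, which always exist locally: $x^i$ of degree 0 ranging over an open set $U\subset\mathbb R^n$, $e^a$ and $e^{\dot a}$ of degree 1 (collectively $e^\alpha$), $p_i$ of degree 2, where $\iota$ fixes $x^i,p_i,e^a$ and sends $e^{\dot a}\mapsto -e^{\dot a}$. Functions on $\mathcal E$ are $C^\infty(U)\otimes \mathrm{Sym}(p_i)\otimes\Lambda(e^\alpha)$. The symplectic form has constant coefficients; its Poisson bracket satisfies $\{p_i,x^j\}=\delta_i^j$, $\{e^\alpha,e^\beta\}=g^{\alpha\beta}$ and vanishes on all other pairs of coordinates (up to order), where $g_{\alpha\beta}$ is a constant symmetric invertible matrix, block diagonal with blocks $g_{ab}$, $g_{\dot a\dot b}$, used to raise and lower indices. Let $Q_{\mathcal E}$ be a degree 1 vector field on $\mathcal E$ (a degree 1 graded derivation of the algebra of functions) that is symplectic (a graded derivation of the Poisson bracket) and satisfies $Q_{\mathcal E}^2=0$. Let $\mathcal V\to\mathcal E$ be the pullback of the bundle $\mathcal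 V_1\to\mathcal E_0$ of fixed points of $\iota$ in $\mathcal E_1$, with fibre coordinates $\xi^a$ of degree 1. Functions on $\mathcal V$ are $C^\infty(U)\otimes \mathrm{Sym}(p_i)\otimes\Lambda(e^\alpha,\xi^a)$, sections of $\mathcal V^*$ are the functions on $\mathcal V$ that are linear in $\xi$, and the induced involution on functions on $\mathcal V$ fixes $\xi^a$. The tautological section is $\tau=e_a\xi^a$ with $e_a=g_{ab}e^b$. A *connection* on $\mathcal V^*\to\mathcal E$ is a degree 1 vector field $Q$ on $\mathcal V$ which projects to $Q_{\mathcal E}$ and preserves $\Gamma(\mathcal V^*)$. Its *torsion* is $Q\tau$, which is called *invariant* if it is fixed by the involution; its *curvature* is $Q^2$. Let $\mathrm{End}_2$ be the space of degree 2 vector fields on $\mathcal V$ that vanish on functions pulled back from $\mathcal E$ and preserve $\Gamma(\mathcal V^*)$. For $D\in\mathrm{End}_2$ let $\pi D$ be its anti-self-dual part under the involution, and $C D=\partial_{e^a}\big((\pi D)\xi^a\big)$ (left derivatives, summed over $a$). The *Ricci tensor* is $\mathrm{Ric}=C Q^2$. **Theorem.** 1. There are unique smooth functions $\rho^i_\alpha$,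 $c_{\alpha\beta\gamma}$ on $U$, with $c$ totally antisymmetric, such that $Q_{\mathcal E}=\{H,\cdot\}$ for $H=\rho^i_\alpha p_ie^\alpha-\tfrac16c_{\alpha\beta\gamma}e^\alpha e^\beta e^\gamma$. 2. For every connection $Q$ there are unique smooth functions $\psi^a{}_{b\alpha}$ on $U$ with $Q\xi^a=\psi^a{}_{b\alpha}e^\alpha\xi^b$, and every choice of smooth functions $\psi^a{}_{b\alpha}$ arises from exactly one connection. The curvature $Q^2$ of a connection lies in $\mathrm{End}_2$. 3. The torsion of $Q$ is invariant if and only if $\psi^a{}_{b\dot a}=c^a{}_{b\dot a}$ for all $a,b,\dot a$. 4. If the torsion of $Q$ is invariant, then, with $\lambda_b:=\psi^a{}_{ba}$, $$\mathrm{Ric}=\big(c^c{}_{b\dot a}\lambda_c-\rho^i_a\,c^a{}_{b\dot a,i}+\rho^i_{\dot a}\lambda_{b,i}+c_{\dot c a\dot a}\,c^{a}{}_{b}{}^{\dot c}\big)\,\xi^b e^{\dot a},$$ where ${}_{,i}$ denotes $\partial/\partial x^i$. In particular, any two connections with invariant torsion and the same trace $\lambda_b$ have the same Ricci tensor, so $\mathrm{Ric}$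 depends on the free coefficients $\psi^a{}_{bc}$ only through $\lambda_b$. 5. Consider the Courant algebroid over $U$ with frame $e_\alpha$, $\langle e_\alpha,e_\beta\rangle=g_{\alpha\beta}$, anchor $\rho(e_\alpha)=\rho^i_\alpha\partial_i$, Dorfman bracket determined by $[e_\alpha,e_\beta]=c_{\alpha\beta}{}^\gamma e_\gamma$, and $V_+=\langle e_a\rangle$, $V_-=V_+^\perp=\langle e_{\dot a}\rangle$. A divergence operator is an $\mathbb R$-linear map $\mathrm{div}$ from sections to $C^\infty(U)$ with $\mathrm{div}(fu)=f\,\mathrm{div}\,u+\rho(u)f$. For such an operator and $u\in\Gamma(V_+)$, $v\in\Gamma(V_-)$ put $$\mathrm{GRic}_{V_+,\mathrm{div}}(u,v)=\mathrm{div}\,[v,u]_+-\rho(v)(\mathrm{div}\,u)-\mathrm{Tr}_{V_+}\big[[\,\cdot\,,v]_-,u\big]_+ .$$ If the torsion of $Q$ is invariant, then divergence operators with $\mathrm{div}(e_a)=-\lambda_a$ for all $a$ exist, and for every such operator $$\mathrm{Ric}=\mathrm{GRic}_{V_+,\mathrm{div}}(e_b,e_{\dot a})\,\xi^be^{\dot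 a}.$$ -/

import Mathlib

open scoped TensorProduct ContDiff
open TopologicalSpace

noncomputable section

namespace GradedRicci

/-! ## Smooth functions on an open subset of coordinate space -/

section Smooth

variable {I : Type*}

/-- Extension by zero of a function defined on an open set. -/
def extendZero {U : Opens (I → ℝ)} (f : U → ℝ) : (I → ℝ) → ℝ :=
  open Classical in fun x => if h : x ∈ U then f ⟨x, h⟩ else 0

theorem extendZero_apply {U : Opens (I → ℝ)} (f : U → ℝ) {x : I → ℝ} (h : x ∈ U) :
    extendZero f x = f ⟨x, h⟩ := by
  simp [extendZero, h]

variable [Fintype I]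

/-- The algebra `C^∞(U)` of smooth real functions on the open set `U`. -/
def SmoothFun (U : Opens (I → ℝ)) : Subalgebra ℝ (U → ℝ) where
  carrier := {f | ContDiffOn ℝ ∞ (extendZero f) (U : Set (I → ℝ))}
  mul_mem' {f g} hf hg := (hf.mul hg).congr fun x hx => by
    simp [extendZero_apply _ (show x ∈ U from hx)]
  add_mem' {f g} hf hg := (hf.add hg).congr fun x hx => by
    simp [extendZero_apply _ (show x ∈ U from hx)]
  algebraMap_mem' r := (contDiffOn_const (c := r)).congr fun x hx => by
    simp [extendZero_apply _ (show x ∈ U from hx)]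

theorem SmoothFun.differentiable_extend {U : Opens (I → ℝ)} (f : SmoothFun U) (x : U) :
    DifferentiableAt ℝ (extendZero f.1) x.1 :=
  ((show ContDiffOn ℝ ∞ (extendZero f.1) (U : Set (I → ℝ)) from f.2).contDiffAt
    (U.isOpen.mem_nhds x.2)).differentiableAt (by simp)

variable [DecidableEq I]

/-- The partial derivative `∂f/∂x^i` of a smooth function, as a linear operator on `C^∞(U)`. -/
def partialX (U : Opens (I → ℝ)) (i : I) : SmoothFun U →ₗ[ℝ] SmoothFun U where
  toFun f := ⟨fun x => fderiv ℝ (extendZero f.1) x.1 (Pi.single i 1), by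
    have h1 : ContDiffOn ℝ ∞ (fderiv ℝ (extendZero f.1)) (U : Set (I → ℝ)) :=
      (show ContDiffOn ℝ ∞ (extendZero f.1) (U : Set (I → ℝ)) from f.2).fderiv_of_isOpen
        U.isOpen (by simp)
    exact (h1.clm_apply (contDiffOn_const (c := Pi.single i 1))).congr fun x hx =>
      extendZero_apply _ (show x ∈ U from hx)⟩
  map_add' f g := by
    ext x
    have h : extendZero (f + g).1 =ᶠ[nhds x.1] extendZero f.1 + extendZero g.1 := by
      filter_upwards [U.isOpen.mem_nhds x.2] with y hy
      simp [extendZero_apply _ (show y ∈ U from hy)]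
    change fderiv ℝ (extendZero (f + g).1) x.1 _ = _
    rw [h.fderiv_eq, fderiv_add (SmoothFun.differentiable_extend f x) (SmoothFun.differentiable_extend g x)]
    rfl
  map_smul' r f := by
    ext x
    have h : extendZero (r • f).1 =ᶠ[nhds x.1] r • extendZero f.1 := by
      filter_upwards [U.isOpen.mem_nhds x.2] with y hy
      simp [extendZero_apply _ (show y ∈ U from hy)]
    change fderiv ℝ (extendZero (r • f).1) x.1 _ = _
    rw [h.fderiv_eq, fderiv_const_smul (SmoothFun.differentiable_extend f x)]
    rfl

end Smooth

/-! ## Graded domains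

Functions on the graded domain with coordinates `x^i` (degree 0, ranging over `U`), `p_i` (degree 2)
and `θ^s`, `s ∈ S` (degree 1): the algebra `C^∞(U) ⊗ Sym(p) ⊗ Λ(θ)`. The first two factors are even,
so the ordinary tensor product of algebras is the graded one. -/

section GradedDomain

variable {I : Type*} [Fintype I]

/-- Functions on the graded domain, before the algebra structure is made available on `GFun`. -/
abbrev GFunTensor (U : Opens (I → ℝ)) (S : Type*) : Type _ :=
  SmoothFun U ⊗[ℝ] (MvPolynomial I ℝ ⊗[ℝ] ExteriorAlgebra ℝ (S → ℝ))

/-- Functions on the graded domain: a synonym of `GFunTensor`, which keeps instance search short. -/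
def GFun (U : Opens (I → ℝ)) (S : Type*) : Type _ := GFunTensor U S

instance (U : Opens (I → ℝ)) (S : Type*) : Ring (GFun U S) :=
  inferInstanceAs (Ring (GFunTensor U S))

instance (U : Opens (I → ℝ)) (S : Type*) : Algebra ℝ (GFun U S) :=
  inferInstanceAs (Algebra ℝ (GFunTensor U S))

variable {U : Opens (I → ℝ)} {S T : Type*}

/-- A function of the degree 0 coordinates, as a function on the graded domain. -/
def base (f : SmoothFun U) : GFun U S := (f ⊗ₜ[ℝ] 1 : GFunTensor U S)

/-- The degree 2 coordinate `p_i`. -/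
def mom (i : I) : GFun U S :=
  (1 ⊗ₜ[ℝ] (MvPolynomial.X i ⊗ₜ[ℝ] 1) : GFunTensor U S)

/-- The degree 1 coordinate `θ^s`. -/
def odd [DecidableEq S] (s : S) : GFun U S :=
  (1 ⊗ₜ[ℝ] (1 ⊗ₜ[ℝ] ExteriorAlgebra.ι ℝ (Pi.single s 1)) : GFunTensor U S)

/-- The functions of degree `k`: sums of monomials `f(x) p^m θ^{s₁} ⋯ θ^{sᵣ}` with `2|m| + r = k`. -/
def homog (U : Opens (I → ℝ)) (S : Type*) [DecidableEq S] (k : ℕ) : Submodule ℝ (GFun U S) :=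
  Submodule.span ℝ {F | ∃ (f : SmoothFun U) (m : I →₀ ℕ) (l : List S),
    2 * m.degree + l.length = k ∧
    F = (f ⊗ₜ[ℝ] (MvPolynomial.monomial m 1 ⊗ₜ[ℝ]
      (l.map fun s => ExteriorAlgebra.ι ℝ (Pi.single s (1 : ℝ))).prod) : GFunTensor U S)}

/-- The parity automorphism `F ↦ (-1)^{|F|} F`. -/
def parity : GFun U S →ₐ[ℝ] GFun U S :=
  (Algebra.TensorProduct.map (AlgHom.id ℝ _)
    (Algebra.TensorProduct.map (AlgHom.id ℝ _) CliffordAlgebra.involute) :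
      GFunTensor U S →ₐ[ℝ] GFunTensor U S)

/-- The algebra map which fixes `x` and `p` and acts on the odd coordinates by a
linear substitution. -/
def subst (L : (S → ℝ) →ₗ[ℝ] (T → ℝ)) : GFun U S →ₐ[ℝ] GFun U T :=
  (Algebra.TensorProduct.map (AlgHom.id ℝ _)
    (Algebra.TensorProduct.map (AlgHom.id ℝ _) (ExteriorAlgebra.map L)) :
      GFunTensor U S →ₐ[ℝ] GFunTensor U T)

/-- The coordinate vector field `∂/∂x^i`. -/
def dX [DecidableEq I] (i : I) : Module.End ℝ (GFun U S) :=
  (LinearMap.rTensor _ (partialX U i) : GFunTensor U S →ₗ[ℝ] GFunTensor U S)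

/-- The coordinate vector field `∂/∂p_i`. -/
def dP (i : I) : Module.End ℝ (GFun U S) :=
  (LinearMap.lTensor _ (LinearMap.rTensor _ (MvPolynomial.pderiv i).toLinearMap) :
    GFunTensor U S →ₗ[ℝ] GFunTensor U S)

/-- The coordinate vector field `∂/∂θ^s` (left derivative). -/
def dOdd (s : S) : Module.End ℝ (GFun U S) :=
  (LinearMap.lTensor _ (LinearMap.lTensor _
    (CliffordAlgebra.contractLeft (Q := (0 : QuadraticForm ℝ (S → ℝ)))
      (LinearMap.proj s : (S → ℝ) →ₗ[ℝ] ℝ))) : GFunTensor U S →ₗ[ℝ] GFunTensor U S)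

/-- Vector fields of degree `k`: graded derivations of degree `k` of the algebra of functions. -/
structure IsVectorField [DecidableEq S] (k : ℕ) (D : Module.End ℝ (GFun U S)) : Prop where
  degree : ∀ (j : ℕ) (F : GFun U S), F ∈ homog U S j → D F ∈ homog U S (j + k)
  leibniz : ∀ F G : GFun U S, D (F * G) = D F * G + ((parity^[k]) F) * D G

end GradedDomain

/-! ## The symplectic structure, the homological vector field and the generalized metric

The coordinates on `𝓔` are `x^i`, `e^a` (`a : P`), `e^{ȧ}` (`ȧ : N`), `p_i`; the index
`α : P ⊕ N` labels all `e^α`. The coordinates on `𝓥` have one more family `ξ^a` (`a : P`). -/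

section Structures

variable {I P N : Type*} [Fintype I] [Fintype P] [Fintype N]
  [DecidableEq I] [DecidableEq P] [DecidableEq N] {U : Opens (I → ℝ)}

/-- Functions on `𝓔`. -/
abbrev FunE (U : Opens (I → ℝ)) (P N : Type*) : Type _ := GFun U (P ⊕ N)

/-- Functions on `𝓥`. -/
abbrev FunV (U : Opens (I → ℝ)) (P N : Type*) : Type _ := GFun U ((P ⊕ N) ⊕ P)

/-- The fibre metric `g_{αβ}`, block diagonal with blocks `g_{ab}` and `g_{ȧḃ}`. -/
def fullMetric (g : Matrix P P ℝ) (g' : Matrix N N ℝ) : Matrix (P ⊕ N) (P ⊕ N) ℝ :=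
  Matrix.fromBlocks g 0 0 g'

/-- The Poisson bracket of degree `-2` on functions on `𝓔` defined by the symplectic form, normalized
by `{p_i, x^j} = δ_i^j` and `{e^α, e^β} = g^{αβ}`. The right derivative by `e^α` is
`parity ∘ ∂/∂e^α`. -/
def poisson (G : Matrix (P ⊕ N) (P ⊕ N) ℝ) (F K : FunE U P N) : FunE U P N :=
  ∑ i : I, (dP i F * dX i K - dX i F * dP i K)
    + ∑ α : P ⊕ N, ∑ β : P ⊕ N, G⁻¹ α β • (parity (dOdd α F) * dOdd β K)

/-- `Q_𝓔` is a degree 1 symplectic vector field with `Q_𝓔² = 0`. -/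
structure IsHomological (G : Matrix (P ⊕ N) (P ⊕ N) ℝ) (QE : Module.End ℝ (FunE U P N)) :
    Prop where
  isVectorField : IsVectorField 1 QE
  symplectic : ∀ F K : FunE U P N,
    QE (poisson G F K) = poisson G (QE F) K + poisson G (parity F) (QE K)
  sq_zero : ∀ F : FunE U P N, QE (QE F) = 0

/-- `H = ρ^i_α p_i e^α - (1/6) c_{αβγ} e^α e^β e^γ`; the arguments are `ρ α i` and `c α β γ`. -/
def hamiltonian (ρ : P ⊕ N → I → SmoothFun U) (c : P ⊕ N → P ⊕ N → P ⊕ N → SmoothFun U) :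
    FunE U P N :=
  ∑ α, ∑ i, base (ρ α i) * mom i * odd α
    - (1 / 6 : ℝ) • ∑ α, ∑ β, ∑ γ, base (c α β γ) * odd α * odd β * odd γ

/-- `ρ`, `c` are the structure functions of `Q_𝓔`: `c` is totally antisymmetric and `Q_𝓔 = {H, ·}`. -/
structure IsStructureFunctions (G : Matrix (P ⊕ N) (P ⊕ N) ℝ) (QE : Module.End ℝ (FunE U P N))
    (ρ : P ⊕ N → I → SmoothFun U) (c : P ⊕ N → P ⊕ N → P ⊕ N → SmoothFun U) : Prop where
  antisymm_left : ∀ α β γ, c β α γ = - c α β γ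
  antisymm_right : ∀ α β γ, c α γ β = - c α β γ
  hamiltonian_eq : ∀ F : FunE U P N, QE F = poisson G (hamiltonian ρ c) F

/-! ## The bundle `𝓥 → 𝓔`, connections, torsion, curvature, contraction -/

/-- The coordinate `e^α` on `𝓥`. -/
def eV (α : P ⊕ N) : FunV U P N := odd (Sum.inl α)

/-- The fibre coordinate `ξ^a` on `𝓥`. -/
def xi (a : P) : FunV U P N := odd (Sum.inr a)

/-- Pullback of functions along the projection `𝓥 → 𝓔`. -/
def pullback : FunE U P N →ₐ[ℝ] FunV U P N :=
  subst (LinearMap.pi (Sum.elim (fun α => LinearMap.proj α) (fun _ => 0)))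

/-- The involution of functions on `𝓥` induced by the generalized metric `ι`: it fixes `x^i`, `p_i`,
`e^a`, `ξ^a` and sends `e^{ȧ}` to `-e^{ȧ}`. -/
def involutionV : FunV U P N →ₐ[ℝ] FunV U P N :=
  subst (LinearMap.pi (Sum.elim
    (Sum.elim (fun a => LinearMap.proj (Sum.inl (Sum.inl a)))
      (fun b => - LinearMap.proj (Sum.inl (Sum.inr b))))
    (fun a => LinearMap.proj (Sum.inr a))))

/-- Sections of `𝓥* → 𝓔`, as functions on `𝓥` linear in the fibre coordinates. -/
def dualSections (U : Opens (I → ℝ)) (P N : Type*) [Fintype P] [DecidableEq P] [DecidableEq N] :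
    Set (FunV U P N) :=
  {s | ∃ F : P → FunE U P N, s = ∑ a, pullback (F a) * xi a}

/-- The tautological section `τ = e_a ξ^a` with `e_a = g_{ab} e^b`. -/
def tautological (U : Opens (I → ℝ)) (N : Type*) [DecidableEq N] (g : Matrix P P ℝ) :
    FunV U P N :=
  ∑ a, (∑ b, g a b • eV (Sum.inl b)) * xi a

/-- A connection on `𝓥* → 𝓔`: a degree 1 vector field on `𝓥` which projects to `Q_𝓔` and preserves
sections of `𝓥*`. -/
structure IsConnection (QE : Module.End ℝ (FunE U P N)) (Q : Module.End ℝ (FunV U P N)) :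
    Prop where
  isVectorField : IsVectorField 1 Q
  projects : ∀ F : FunE U P N, Q (pullback F) = pullback (QE F)
  preserves : ∀ s ∈ dualSections U P N, Q s ∈ dualSections U P N

/-- The coefficients `ψ^a_{bα}` (written `ψ a b α`) of a connection:
`Q ξ^a = ψ^a_{bα} e^α ξ^b`. -/
def HasCoefficients (Q : Module.End ℝ (FunV U P N)) (ψ : P → P → P ⊕ N → SmoothFun U) : Prop :=
  ∀ a, Q (xi a) = ∑ b, ∑ α, base (ψ a b α) * eV α * xi b

/-- The torsion `Q τ` is invariant under the involution. -/
def HasInvariantTorsion (g : Matrix P P ℝ) (Q : Module.End ℝ (FunV U P N)) : Prop :=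
  involutionV (Q (tautological U N g)) = Q (tautological U N g)

/-- The space `End₂` of degree 2 bundle endomorphisms of `𝓥*`, as vector fields on `𝓥`. -/
structure IsEndTwo (D : Module.End ℝ (FunV U P N)) : Prop where
  isVectorField : IsVectorField 2 D
  vertical : ∀ F : FunE U P N, D (pullback F) = 0
  preserves : ∀ s ∈ dualSections U P N, D s ∈ dualSections U P N

/-- The anti-self-dual part `πD` of a vector field on `𝓥` with respect to the involution. -/
def antiSelfDual (D : Module.End ℝ (FunV U P N)) : Module.End ℝ (FunV U P N) :=
  (1 / 2 : ℝ) • (D - involutionV.toLinearMap ∘ₗ D ∘ₗ involutionV.toLinearMap)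

/-- The contraction `C : D ↦ ∂_{e^a} (πD) ξ^a`. -/
def contraction (D : Module.End ℝ (FunV U P N)) : FunV U P N :=
  ∑ a : P, dOdd (Sum.inl (Sum.inl a)) (antiSelfDual D (xi a))

/-- The curvature `Q² = ½[Q, Q]` of a connection. -/
def curvature (Q : Module.End ℝ (FunV U P N)) : Module.End ℝ (FunV U P N) := Q ∘ₗ Q

/-- The Ricci tensor `Ric = C Q²`. -/
def ricci (Q : Module.End ℝ (FunV U P N)) : FunV U P N := contraction (curvature Q)

/-- The section `Σ R_{bȧ} ξ^b e^{ȧ}` with components `R b ȧ`. -/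
def tensorOf (R : P → N → SmoothFun U) : FunV U P N :=
  ∑ b, ∑ d, base (R b d) * xi b * eV (Sum.inr d)

/-- `λ_b = ψ^a_{ba}`. -/
def traceCoeff (ψ : P → P → P ⊕ N → SmoothFun U) (b : P) : SmoothFun U :=
  ∑ a, ψ a b (Sum.inl a)

/-- `c^a_{bȧ} = g^{ad} c_{dbȧ}`. -/
def cUp (g : Matrix P P ℝ) (c : P ⊕ N → P ⊕ N → P ⊕ N → SmoothFun U) (a b : P) (d : N) :
    SmoothFun U :=
  ∑ k, g⁻¹ a k • c (Sum.inl k) (Sum.inl b) (Sum.inr d)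

/-- `c^a_b{}^ċ = g^{ad} g^{ċḟ} c_{dbḟ}`. -/
def cUpUp (g : Matrix P P ℝ) (g' : Matrix N N ℝ) (c : P ⊕ N → P ⊕ N → P ⊕ N → SmoothFun U)
    (a b : P) (k : N) : SmoothFun U :=
  ∑ f, g'⁻¹ k f • cUp g c a b f

/-- The components
`c^c_{bȧ} λ_c - ρ^i_a c^a_{bȧ,i} + ρ^i_ȧ λ_{b,i} + c_{ċaȧ} c^a_b{}^ċ`. -/
def ricciComponent (g : Matrix P P ℝ) (g' : Matrix N N ℝ) (ρ : P ⊕ N → I → SmoothFun U)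
    (c : P ⊕ N → P ⊕ N → P ⊕ N → SmoothFun U) (lam : P → SmoothFun U) (b : P) (d : N) :
    SmoothFun U :=
  ∑ k, cUp g c k b d * lam k
    - ∑ a, ∑ i, ρ (Sum.inl a) i * partialX U i (cUp g c a b d)
    + ∑ i, ρ (Sum.inr d) i * partialX U i (lam b)
    + ∑ k, ∑ a, c (Sum.inr k) (Sum.inl a) (Sum.inr d) * cUpUp g g' c a b k

/-! ## The Courant algebroid and its generalized Ricci tensor

Sections of the Courant algebroid are written `u = u^α e_α` in the frame with
`⟨e_α, e_β⟩ = g_{αβ}` and `[e_α, e_β] = c_{αβ}{}^γ e_γ`. -/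

/-- The anchor: `ρ(u) f = u^α ρ^i_α ∂_i f`. -/
def anchor (ρ : P ⊕ N → I → SmoothFun U) (u : P ⊕ N → SmoothFun U) (f : SmoothFun U) :
    SmoothFun U :=
  ∑ α, ∑ i, u α * ρ α i * partialX U i f

/-- The Courant (Dorfman) bracket with structure functions `ρ`, `c`:
`[u,v]^γ = ρ(u) v^γ - ρ(v) u^γ + g^{γδ} ⟨ρ(e_δ) u, v⟩ + g^{γδ} c_{αβδ} u^α v^β`. -/
def courant (G : Matrix (P ⊕ N) (P ⊕ N) ℝ) (ρ : P ⊕ N → I → SmoothFun U)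
    (c : P ⊕ N → P ⊕ N → P ⊕ N → SmoothFun U) (u v : P ⊕ N → SmoothFun U) :
    P ⊕ N → SmoothFun U := fun γ =>
  anchor ρ u (v γ) - anchor ρ v (u γ)
    + ∑ δ, G⁻¹ γ δ • (∑ α, ∑ β, G α β • (anchor ρ (Pi.single δ 1) (u α) * v β)
      + ∑ α, ∑ β, c α β δ * u α * v β)

/-- The projection to `V₊`. -/
def projPlus (u : P ⊕ N → SmoothFun U) : P ⊕ N → SmoothFun U :=
  Sum.elim (fun a => u (Sum.inl a)) (fun _ => 0)

/-- The projection to `V₋ = V₊^⊥`. -/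
def projMinus (u : P ⊕ N → SmoothFun U) : P ⊕ N → SmoothFun U :=
  Sum.elim (fun _ => 0) (fun d => u (Sum.inr d))

/-- Divergence operators: `div (f u) = f div u + ρ(u) f`. -/
structure IsDivergence (ρ : P ⊕ N → I → SmoothFun U)
    (dvg : (P ⊕ N → SmoothFun U) →ₗ[ℝ] SmoothFun U) : Prop where
  leibniz : ∀ (f : SmoothFun U) (u : P ⊕ N → SmoothFun U),
    dvg (fun α => f * u α) = f * dvg u + anchor ρ u f

/-- The generalized Ricci tensor
`GRic_{V₊,div}(u,v) = div [v,u]₊ - ρ(v) (div u) - Tr_{V₊} [[·,v]₋,u]₊`,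
for `u ∈ Γ(V₊)`, `v ∈ Γ(V₋)`. -/
def gRic (G : Matrix (P ⊕ N) (P ⊕ N) ℝ) (ρ : P ⊕ N → I → SmoothFun U)
    (c : P ⊕ N → P ⊕ N → P ⊕ N → SmoothFun U)
    (dvg : (P ⊕ N → SmoothFun U) →ₗ[ℝ] SmoothFun U) (u v : P ⊕ N → SmoothFun U) : SmoothFun U :=
  dvg (projPlus (courant G ρ c v u)) - anchor ρ v (dvg u)
    - ∑ a : P, projPlus
        (courant G ρ c (projMinus (courant G ρ c (Pi.single (Sum.inl a) 1) v)) u) (Sum.inl a)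

end Structures

end GradedRicci

end

/-! A graded derivation is fixed by its values on the functions of `x` and on the coordinates `p_i`,
`θ^s`, and a function of degree at most 2 has an explicit normal form (`exists_of_mem_homog`). The
theorem is therefore a computation on generators, in which coefficients are read off by odd
derivatives and `base_injective`.

Structure functions. Bracketing with the lowered coordinate `e_α` is the derivative by `e^α`, so the
symplectic condition becomes a commutation rule between `Q_𝓔` and the odd derivatives
(`map_lowered_poisson`). The function `Q_𝓔 e_α` has degree 2; its normal form supplies `ρ` and `c`,
and applying `Q_𝓔` to the constant `{e_α, e_β}` makes `c` totally antisymmetric. The same rule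
forces `Q_𝓔 = {H, ·}` on functions of `x`. On `p_i` the discrepancy has degree 3 and no odd
derivative, hence vanishes (`eq_zero_of_dOdd_eq_zero`). Uniqueness holds because `Q_𝓔 e_α = ∂_α H`
contains `ρ_α` and `c_α`. The condition `Q_𝓔² = 0` is needed only to make the curvature vertical.

Connections. A connection is `Q_𝓔` on the base together with the values `Q ξ^a`, of degree 2 and
linear in `ξ`, so the `ψ` are free.

Torsion and Ricci. Both `Q τ` and `Q² ξ^a` have the shape `f p ξ + h e e ξ`. On such functions the
involution changes only the terms with exactly one dotted `e`, and these depend on `h` through its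
mixed antisymmetrization (`sub_involutionV`). For the torsion this gives `ψ^a_{bȧ} = c^a_{bȧ}`. For
the curvature it gives a formula for `Ric` (`ricci_eq`) in which, once the torsion condition is
inserted, the two terms containing the untraced `ψ^a_{bc}` cancel and only the trace `λ` remains.

Courant algebroid. On the frame the Dorfman bracket is given by `c`, and orthogonality of `V₊` and
`V₋` removes every derivative term from the iterated bracket. What remains of `GRic` is the same
expression (`gRic_frame`). -/

set_option linter.unusedSectionVars false

namespace GradedRicci

/-! ### Monomials, degrees and supercommutativity on a graded domain. -/

section Monomials

variable {I : Type*} [Fintype I] {U : Opens (I → ℝ)} {S T : Type*}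

/-- The function `f(x) q(p) w(θ)` on the graded domain. -/
noncomputable def pureFun (f : SmoothFun U) (q : MvPolynomial I ℝ) (w : ExteriorAlgebra ℝ (S → ℝ)) :
    GFun U S :=
  (f ⊗ₜ[ℝ] (q ⊗ₜ[ℝ] w) : GFunTensor U S)

theorem pureFun_mul (f f' : SmoothFun U) (q q' : MvPolynomial I ℝ)
    (w w' : ExteriorAlgebra ℝ (S → ℝ)) :
    pureFun f q w * pureFun f' q' w' = pureFun (f * f') (q * q') (w * w') := by
  change ((f ⊗ₜ[ℝ] (q ⊗ₜ[ℝ] w) : GFunTensor U S) * (f' ⊗ₜ[ℝ] (q' ⊗ₜ[ℝ] w') : GFunTensor U S)) = _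
  rw [Algebra.TensorProduct.tmul_mul_tmul, Algebra.TensorProduct.tmul_mul_tmul]
  rfl

theorem pureFun_add_left (f f' : SmoothFun U) (q : MvPolynomial I ℝ)
    (w : ExteriorAlgebra ℝ (S → ℝ)) :
    pureFun (f + f') q w = pureFun f q w + pureFun f' q w :=
  TensorProduct.add_tmul _ _ _

theorem pureFun_add_mid (f : SmoothFun U) (q q' : MvPolynomial I ℝ)
    (w : ExteriorAlgebra ℝ (S → ℝ)) :
    pureFun f (q + q') w = pureFun f q w + pureFun f q' w := by
  change (f ⊗ₜ[ℝ] ((q + q') ⊗ₜ[ℝ] w) : GFunTensor U S) = _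
  rw [TensorProduct.add_tmul, TensorProduct.tmul_add]
  rfl

theorem pureFun_add_right (f : SmoothFun U) (q : MvPolynomial I ℝ)
    (w w' : ExteriorAlgebra ℝ (S → ℝ)) :
    pureFun f q (w + w') = pureFun f q w + pureFun f q w' := by
  change (f ⊗ₜ[ℝ] (q ⊗ₜ[ℝ] (w + w')) : GFunTensor U S) = _
  rw [TensorProduct.tmul_add, TensorProduct.tmul_add]
  rfl

theorem pureFun_smul_left (r : ℝ) (f : SmoothFun U) (q : MvPolynomial I ℝ)
    (w : ExteriorAlgebra ℝ (S → ℝ)) :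
    pureFun (r • f) q w = r • pureFun f q w :=
  TensorProduct.smul_tmul' _ _ _ |>.symm

theorem pureFun_smul_mid (r : ℝ) (f : SmoothFun U) (q : MvPolynomial I ℝ)
    (w : ExteriorAlgebra ℝ (S → ℝ)) :
    pureFun f (r • q) w = pureFun (r • f) q w := by
  change (f ⊗ₜ[ℝ] ((r • q) ⊗ₜ[ℝ] w) : GFunTensor U S) = ((r • f) ⊗ₜ[ℝ] (q ⊗ₜ[ℝ] w) : GFunTensor U S)
  rw [← TensorProduct.smul_tmul', TensorProduct.smul_tmul]

theorem pureFun_smul_right (r : ℝ) (f : SmoothFun U) (q : MvPolynomial I ℝ)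
    (w : ExteriorAlgebra ℝ (S → ℝ)) :
    pureFun f q (r • w) = pureFun (r • f) q w := by
  change (f ⊗ₜ[ℝ] (q ⊗ₜ[ℝ] (r • w)) : GFunTensor U S) = ((r • f) ⊗ₜ[ℝ] (q ⊗ₜ[ℝ] w) : GFunTensor U S)
  rw [TensorProduct.tmul_smul, TensorProduct.smul_tmul]

theorem base_eq (f : SmoothFun U) : (base f : GFun U S) = pureFun f 1 1 := rfl

theorem mom_eq (i : I) : (mom i : GFun U S) = pureFun 1 (MvPolynomial.X i) 1 := rfl

theorem odd_eq [DecidableEq S] (s : S) :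
    (odd s : GFun U S) = pureFun 1 1 (ExteriorAlgebra.ι ℝ (Pi.single s 1)) := rfl

theorem base_mul (f g : SmoothFun U) : (base (f * g) : GFun U S) = base f * base g := by
  simp [base_eq, pureFun_mul]

theorem base_add (f g : SmoothFun U) : (base (f + g) : GFun U S) = base f + base g :=
  pureFun_add_left _ _ _ _

theorem base_smul (r : ℝ) (f : SmoothFun U) : (base (r • f) : GFun U S) = r • base f :=
  pureFun_smul_left _ _ _ _

/-- The inclusion of the functions of the degree 0 coordinates, as a linear map. -/
noncomputable def baseLin (U : Opens (I → ℝ)) (S : Type*) : SmoothFun U →ₗ[ℝ] GFun U S where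
  toFun := base
  map_add' := base_add
  map_smul' := base_smul

theorem base_zero : (base 0 : GFun U S) = 0 := map_zero (baseLin U S)

theorem base_neg (f : SmoothFun U) : (base (-f) : GFun U S) = -base f := map_neg (baseLin U S) f

theorem base_sub (f g : SmoothFun U) : (base (f - g) : GFun U S) = base f - base g :=
  map_sub (baseLin U S) f g

theorem base_sum {κ : Type*} (s : Finset κ) (f : κ → SmoothFun U) :
    (base (∑ k ∈ s, f k) : GFun U S) = ∑ k ∈ s, base (f k) :=
  map_sum (baseLin U S) f s

/-- Every function is obtained from functions of `x` by sums and left multiplication by `p_i`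
and `θ^s`. -/
theorem GFun.left_induction [Finite S] [DecidableEq S] {C : GFun U S → Prop}
    (hbase : ∀ f, C (base f)) (hmom : ∀ i F, C F → C (mom i * F))
    (hodd : ∀ s F, C F → C (odd s * F)) (hadd : ∀ F G, C F → C G → C (F + G)) (F : GFun U S) :
    C F := by
  have hzero : C 0 := base_zero (U := U) (S := S) ▸ hbase 0
  have hsum : ∀ {κ : Type _} (s : Finset κ) (G : κ → GFun U S), (∀ k, C (G k)) →
      C (∑ k ∈ s, G k) := by
    intro κ s G hG
    classical
    induction s using Finset.induction_on with
    | empty => simpa using hzero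
    | insert a s ha ih => rw [Finset.sum_insert ha]; exact hadd _ _ (hG a) ih
  have h1 : ∀ (q : MvPolynomial I ℝ) (f : SmoothFun U), C (pureFun f q 1) := by
    intro q
    induction q using MvPolynomial.induction_on with
    | C a =>
      intro f
      have : pureFun f (MvPolynomial.C a) (1 : ExteriorAlgebra ℝ (S → ℝ)) = base (a • f) := by
        rw [base_eq, ← pureFun_smul_mid, MvPolynomial.C_eq_smul_one]
      rw [this]; exact hbase _
    | add p q hp hq => intro f; rw [pureFun_add_mid]; exact hadd _ _ (hp f) (hq f)
    | mul_X p i hp =>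
      intro f
      have : pureFun f (p * MvPolynomial.X i) (1 : ExteriorAlgebra ℝ (S → ℝ))
          = mom i * pureFun f p 1 := by
        rw [mom_eq, pureFun_mul, one_mul, one_mul, mul_comm]
      rw [this]; exact hmom _ _ (hp f)
  have h2 : ∀ (w : ExteriorAlgebra ℝ (S → ℝ)) (q : MvPolynomial I ℝ) (f : SmoothFun U),
      C (pureFun f q w) := by
    intro w
    induction w using CliffordAlgebra.left_induction with
    | algebraMap r =>
      intro q f
      rw [Algebra.algebraMap_eq_smul_one, pureFun_smul_right]
      exact h1 _ _
    | add x y hx hy => intro q f; rw [pureFun_add_right]; exact hadd _ _ (hx q f) (hy q f)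
    | ι_mul x v hx =>
      intro q f
      have := Fintype.ofFinite S
      have hv : v = ∑ s, v s • (Pi.single s 1 : S → ℝ) := by
        ext t; simp [Finset.sum_apply, Pi.single_apply]
      have : pureFun f q (CliffordAlgebra.ι (0 : QuadraticForm ℝ (S → ℝ)) v * x)
          = ∑ s, odd s * pureFun (v s • f) q x := by
        have hL : ∀ y : ExteriorAlgebra ℝ (S → ℝ), pureFun 1 1 y * pureFun f q x
          = pureFun f q (y * x) := fun y => by rw [pureFun_mul, one_mul, one_mul]
        let L : (S → ℝ) →ₗ[ℝ] GFun U S :=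
          { toFun := fun y => pureFun f q (CliffordAlgebra.ι (0 : QuadraticForm ℝ (S → ℝ)) y * x)
            map_add' := fun a b => by rw [map_add, add_mul, pureFun_add_right]
            map_smul' := fun a b => by
              rw [map_smul, smul_mul_assoc, pureFun_smul_right, pureFun_smul_left]; rfl }
        change L v = _
        conv_lhs => rw [hv]
        rw [map_sum]
        refine Finset.sum_congr rfl fun s _ => ?_
        rw [map_smul, pureFun_smul_left, odd_eq, mul_smul_comm, hL]
        rfl
      rw [this]
      exact hsum _ _ fun s => hodd _ _ (hx _ _)
  refine TensorProduct.induction_on (F : GFunTensor U S) hzero (fun f y => ?_) hadd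
  induction y using TensorProduct.induction_on with
  | zero => rw [TensorProduct.tmul_zero]; exact hzero
  | tmul q w => exact h2 w q f
  | add x y hx hy => rw [TensorProduct.tmul_add]; exact hadd _ _ hx hy

theorem GFun.mul_induction [Finite S] [DecidableEq S] {C : GFun U S → Prop}
    (hbase : ∀ f, C (base f)) (hmom : ∀ i, C (mom i)) (hodd : ∀ s, C (odd s))
    (hmul : ∀ F G, C F → C G → C (F * G)) (hadd : ∀ F G, C F → C G → C (F + G)) (F : GFun U S) :
    C F :=
  GFun.left_induction hbase (fun i F => hmul _ F (hmom i)) (fun s F => hmul _ F (hodd s)) hadd F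

/-! ### Degrees -/

/-- Every spanning monomial is built from a function of `x` by multiplying by one `p_i` or `θ^s` at
a time. The predicate depends on the degree, so statements special to low degree can be proved
together in a single induction. -/
theorem homog_induction [DecidableEq S] {C : ℕ → GFun U S → Prop}
    (hbase : ∀ f, C 0 (base f)) (hmom : ∀ i k F, C k F → C (k + 2) (mom i * F))
    (hodd : ∀ s k F, C k F → C (k + 1) (odd s * F)) (hzero : ∀ k, C k 0)
    (hadd : ∀ k F G, C k F → C k G → C k (F + G)) (hsmul : ∀ k (r : ℝ) F, C k F → C k (r • F))
    {k : ℕ} {F : GFun U S} (hF : F ∈ homog U S k) : C k F := by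
  have h1 : ∀ (n : ℕ) (f : SmoothFun U) (m : I →₀ ℕ), m.degree = n →
      C (2 * n) (pureFun f (MvPolynomial.monomial m 1) 1) := by
    intro n
    induction n with
    | zero =>
      intro f m hm
      rw [(Finsupp.degree_eq_zero_iff m).1 hm]
      exact hbase f
    | succ n ih =>
      intro f m hm
      obtain ⟨i, hi⟩ : ∃ i, m i ≠ 0 := by
        by_contra! h
        rw [show m = 0 from Finsupp.ext h] at hm
        simp at hm
      obtain ⟨m', rfl⟩ : ∃ m', m = Finsupp.single i 1 + m' :=
        ⟨m - Finsupp.single i 1, (add_tsub_cancel_of_le (by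
          rw [Finsupp.single_le_iff]; omega)).symm⟩
      have hm' : m'.degree = n := by
        rw [map_add, Finsupp.degree_single] at hm; omega
      have : pureFun f (MvPolynomial.monomial (Finsupp.single i 1 + m') 1)
          (1 : ExteriorAlgebra ℝ (S → ℝ)) = mom i * pureFun f (MvPolynomial.monomial m' 1) 1 := by
        rw [mom_eq, pureFun_mul, one_mul, one_mul, MvPolynomial.X, MvPolynomial.monomial_mul,
          one_mul]
      rw [this]
      exact hmom _ _ _ (ih f m' hm')
  have h2 : ∀ (l : List S) (f : SmoothFun U) (m : I →₀ ℕ),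
      C (2 * m.degree + l.length) (pureFun f (MvPolynomial.monomial m 1)
        (l.map fun s => ExteriorAlgebra.ι ℝ (Pi.single s (1 : ℝ))).prod) := by
    intro l
    induction l with
    | nil => intro f m; exact h1 _ f m rfl
    | cons s l ih =>
      intro f m
      have : pureFun f (MvPolynomial.monomial m 1)
          (((s :: l).map fun s => ExteriorAlgebra.ι ℝ (Pi.single s (1 : ℝ))).prod)
          = odd s * pureFun f (MvPolynomial.monomial m 1)
          ((l.map fun s => ExteriorAlgebra.ι ℝ (Pi.single s (1 : ℝ))).prod) := by
        rw [odd_eq, pureFun_mul, one_mul, one_mul, List.map_cons, List.prod_cons]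
      rw [this]
      exact hodd _ _ _ (ih f m)
  refine Submodule.span_induction (p := fun F _ => C k F) ?_ (hzero k)
    (fun _ _ _ _ => hadd k _ _) (fun r _ _ => hsmul k r _) hF
  rintro _ ⟨f, m, l, rfl, rfl⟩
  exact h2 l f m

theorem pureFun_mem_homog [DecidableEq S] (f : SmoothFun U) (m : I →₀ ℕ) (l : List S) {k : ℕ}
    (h : 2 * m.degree + l.length = k) : pureFun f (MvPolynomial.monomial m 1)
      (l.map fun s => ExteriorAlgebra.ι ℝ (Pi.single s (1 : ℝ))).prod ∈ homog U S k :=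
  Submodule.subset_span ⟨f, m, l, h, rfl⟩

theorem base_mem_homog [DecidableEq S] (f : SmoothFun U) : base f ∈ homog U S 0 :=
  pureFun_mem_homog f 0 [] (by simp)

theorem mom_mem_homog [DecidableEq S] (i : I) : mom i ∈ homog U S 2 :=
  pureFun_mem_homog 1 (Finsupp.single i 1) [] (by simp)

theorem odd_mem_homog [DecidableEq S] (s : S) : odd s ∈ homog U S 1 := by
  have := pureFun_mem_homog (U := U) 1 0 [s] (k := 1) (by simp)
  rwa [List.map_singleton, List.prod_singleton] at this

theorem homog_mul [DecidableEq S] {j k : ℕ} {F G : GFun U S} (hF : F ∈ homog U S j)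
    (hG : G ∈ homog U S k) : F * G ∈ homog U S (j + k) := by
  have h1 : ∀ (f : SmoothFun U) (m : I →₀ ℕ) (l : List S), 2 * m.degree + l.length = j →
      pureFun f (MvPolynomial.monomial m 1)
        (l.map fun s => ExteriorAlgebra.ι ℝ (Pi.single s (1 : ℝ))).prod * G
        ∈ homog U S (j + k) := by
    intro f m l h
    refine Submodule.span_induction (p := fun G _ => pureFun f (MvPolynomial.monomial m 1)
        (l.map fun s => ExteriorAlgebra.ι ℝ (Pi.single s (1 : ℝ))).prod * G
        ∈ homog U S (j + k)) ?_ (by simp)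
      (fun _ _ _ _ h1 h2 => by rw [mul_add]; exact add_mem h1 h2)
      (fun r _ _ h => by rw [mul_smul_comm]; exact Submodule.smul_mem _ _ h) hG
    rintro _ ⟨f', m', l', h', rfl⟩
    have := pureFun_mem_homog (f * f') (m + m') (l ++ l') (k := j + k) (by
      rw [map_add, List.length_append]; omega)
    rwa [List.map_append, List.prod_append, ← one_mul (1 : ℝ), ← MvPolynomial.monomial_mul,
      ← pureFun_mul, one_mul] at this
  refine Submodule.span_induction (p := fun F _ => F * G ∈ homog U S (j + k)) ?_ (by simp)
    (fun _ _ _ _ h1 h2 => by rw [add_mul]; exact add_mem h1 h2)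
    (fun r _ _ h => by rw [smul_mul_assoc]; exact Submodule.smul_mem _ _ h) hF
  rintro _ ⟨f, m, l, h, rfl⟩
  exact h1 f m l h

theorem iSup_homog [Finite S] [DecidableEq S] : ⨆ k, homog U S k = ⊤ := by
  have key : ∀ F G : GFun U S, F ∈ ⨆ k, homog U S k → ∀ j, G ∈ homog U S j →
      G * F ∈ ⨆ k, homog U S k := by
    intro F G hF j hG
    induction hF using Submodule.iSup_induction' with
    | mem k x hx => exact Submodule.mem_iSup_of_mem _ (homog_mul hG hx)
    | zero => simp
    | add x y _ _ hx hy => rw [mul_add]; exact add_mem hx hy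
  refine eq_top_iff.2 fun F _ => ?_
  induction F using GFun.left_induction with
  | hbase f => exact Submodule.mem_iSup_of_mem 0 (base_mem_homog f)
  | hmom i F hF => exact key _ _ (hF trivial) _ (mom_mem_homog i)
  | hodd s F hF => exact key _ _ (hF trivial) _ (odd_mem_homog s)
  | hadd F G hF hG => exact add_mem (hF trivial) (hG trivial)

theorem GFun.homog_sum_induction [Finite S] [DecidableEq S] {C : GFun U S → Prop}
    (hhom : ∀ k, ∀ F ∈ homog U S k, C F) (hadd : ∀ F G, C F → C G → C (F + G)) (F : GFun U S) :
    C F := by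
  have hF : F ∈ ⨆ k, homog U S k := by rw [iSup_homog]; trivial
  induction hF using Submodule.iSup_induction' with
  | mem k x hx => exact hhom k x hx
  | zero => exact hhom 0 0 (zero_mem _)
  | add x y _ _ hx hy => exact hadd _ _ hx hy

/-! ### Parity and supercommutativity -/

theorem parity_pureFun (f : SmoothFun U) (q : MvPolynomial I ℝ) (w : ExteriorAlgebra ℝ (S → ℝ)) :
    parity (pureFun f q w) = pureFun f q (CliffordAlgebra.involute w) := rfl

theorem parity_base (f : SmoothFun U) : parity (base f : GFun U S) = base f := by
  rw [base_eq, parity_pureFun, map_one]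

theorem parity_mom (i : I) : parity (mom i : GFun U S) = mom i := by
  rw [mom_eq, parity_pureFun, map_one]

theorem parity_odd [DecidableEq S] (s : S) : parity (odd s : GFun U S) = -odd s := by
  rw [odd_eq, parity_pureFun, ExteriorAlgebra.ι, CliffordAlgebra.involute_ι, ← neg_one_smul ℝ,
    pureFun_smul_right, pureFun_smul_left, neg_one_smul]

theorem parity_parity [Finite S] [DecidableEq S] (F : GFun U S) : parity (parity F) = F := by
  induction F using GFun.left_induction with
  | hbase g => rw [parity_base, parity_base]
  | hmom i F hF => rw [map_mul, map_mul, hF, parity_mom, parity_mom]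
  | hodd s F hF => rw [map_mul, map_mul, hF, parity_odd, map_neg, parity_odd, neg_neg]
  | hadd F G hF hG => rw [map_add, map_add, hF, hG]

theorem parity_homog [DecidableEq S] {k : ℕ} {F : GFun U S} (hF : F ∈ homog U S k) :
    parity F = (-1 : ℝ) ^ k • F := by
  refine homog_induction (C := fun k F => parity F = (-1 : ℝ) ^ k • F) ?_ ?_ ?_ ?_ ?_ ?_ hF
  · intro f; rw [parity_base, pow_zero, one_smul]
  · intro i k F h; rw [map_mul, h, parity_mom, pow_add, neg_one_sq, mul_one, mul_smul_comm]
  · intro s k F h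
    rw [map_mul, h, parity_odd, pow_succ, mul_neg_one, mul_smul_comm, neg_smul, neg_mul, smul_neg]
  · simp
  · intro k F G h1 h2; rw [map_add, h1, h2, smul_add]
  · intro k r F h; rw [map_smul, h, smul_comm]

theorem base_mul_comm [Finite S] [DecidableEq S] (f : SmoothFun U) (F : GFun U S) :
    base f * F = F * base f := by
  induction F using GFun.left_induction with
  | hbase g => rw [← base_mul, mul_comm, base_mul]
  | hmom i F hF =>
    rw [mul_assoc, ← hF, ← mul_assoc, ← mul_assoc, mom_eq, base_eq, pureFun_mul, pureFun_mul]
    simp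
  | hodd s F hF =>
    rw [mul_assoc, ← hF, ← mul_assoc, ← mul_assoc, odd_eq, base_eq, pureFun_mul, pureFun_mul]
    simp
  | hadd F G hF hG => rw [mul_add, add_mul, hF, hG]

theorem mom_mul_comm [Finite S] [DecidableEq S] (i : I) (F : GFun U S) :
    mom i * F = F * mom i := by
  induction F using GFun.left_induction with
  | hbase g => rw [base_mul_comm]
  | hmom j F hF =>
    rw [mul_assoc, ← hF, ← mul_assoc, ← mul_assoc, mom_eq, mom_eq, pureFun_mul, pureFun_mul,
      mul_comm (MvPolynomial.X i)]
  | hodd s F hF =>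
    rw [mul_assoc, ← hF, ← mul_assoc, ← mul_assoc, odd_eq, mom_eq, pureFun_mul, pureFun_mul]
    simp
  | hadd F G hF hG => rw [mul_add, add_mul, hF, hG]

theorem odd_mul_odd [DecidableEq S] (s t : S) :
    (odd s * odd t : GFun U S) = -(odd t * odd s) := by
  rw [odd_eq, odd_eq, pureFun_mul, pureFun_mul, eq_neg_iff_add_eq_zero, ← pureFun_add_right,
    ExteriorAlgebra.ι_add_mul_swap]
  simp only [mul_one]
  change (_ ⊗ₜ[ℝ] (_ ⊗ₜ[ℝ] 0) : GFunTensor U S) = 0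
  rw [TensorProduct.tmul_zero, TensorProduct.tmul_zero]

theorem odd_mul_comm [Finite S] [DecidableEq S] (s : S) (F : GFun U S) :
    odd s * F = parity F * odd s := by
  induction F using GFun.left_induction with
  | hbase g => rw [parity_base, base_mul_comm]
  | hmom j F hF => rw [map_mul, parity_mom, mul_assoc, ← hF, ← mul_assoc, ← mul_assoc, mom_mul_comm]
  | hodd t F hF =>
    rw [map_mul, parity_odd, mul_assoc, ← hF, ← mul_assoc, ← mul_assoc, odd_mul_odd, neg_mul, neg_mul,
      neg_mul]
  | hadd F G hF hG => rw [mul_add, map_add, add_mul, hF, hG]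

/-- Supercommutativity with only one factor homogeneous: the Koszul sign is carried by iterates of
`parity` on the arbitrary factor, the form in which the Leibniz rule of `IsVectorField` is stated.
-/
theorem homog_mul_comm [Finite S] [DecidableEq S] {k : ℕ} {F : GFun U S} (hF : F ∈ homog U S k)
    (G : GFun U S) : F * G = (parity^[k]) G * F := by
  have hpar : ∀ k, (parity^[k + 2]) G = (parity^[k]) G := fun k => by
    rw [Function.iterate_succ_apply', Function.iterate_succ_apply', parity_parity]
  refine homog_induction (C := fun k F => F * G = (parity^[k]) G * F) ?_ ?_ ?_ ?_ ?_ ?_ hF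
  · intro f; exact base_mul_comm f G
  · intro i k F h; rw [hpar, mul_assoc, h, ← mul_assoc, mom_mul_comm, mul_assoc]
  · intro s k F h; rw [mul_assoc, h, ← mul_assoc, odd_mul_comm, Function.iterate_succ_apply',
      mul_assoc]
  · simp
  · intro k F G h1 h2; rw [add_mul, h1, h2, mul_add]
  · intro k r F h; rw [smul_mul_assoc, h, mul_smul_comm]

end Monomials

/-! ### Graded derivations: coordinate vector fields, low-degree functions, general vector fields.
-/

section Derivations

variable {I : Type*} [Fintype I] {U : Opens (I → ℝ)} {S T : Type*}

theorem GFun.pureFun_induction {C : GFun U S → Prop} (hpure : ∀ f q w, C (pureFun f q w))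
    (hadd : ∀ F G, C F → C G → C (F + G)) (F : GFun U S) : C F := by
  have hzero : C 0 := by
    have := hpure 0 1 1
    rwa [← base_eq, base_zero] at this
  refine TensorProduct.induction_on (F : GFunTensor U S) hzero (fun f y => ?_) hadd
  induction y using TensorProduct.induction_on with
  | zero => rw [TensorProduct.tmul_zero]; exact hzero
  | tmul q w => exact hpure f q w
  | add x y hx hy => rw [TensorProduct.tmul_add]; exact hadd _ _ hx hy

/-- Since `σ` and `φ` are multiplicative, the left factors satisfying the rule against every `G` are
closed under products, so generators suffice on the left. -/
theorem leibniz_of_generators [Finite S] [DecidableEq S] {A : Type*} [Ring A] [Algebra ℝ A]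
    {D : GFun U S →ₗ[ℝ] A} {σ φ : GFun U S →ₐ[ℝ] A}
    (hbase : ∀ f G, D (base f * G) = D (base f) * φ G + σ (base f) * D G)
    (hmom : ∀ i G, D (mom i * G) = D (mom i) * φ G + σ (mom i) * D G)
    (hodd : ∀ s G, D (odd s * G) = D (odd s) * φ G + σ (odd s) * D G) (F G : GFun U S) :
    D (F * G) = D F * φ G + σ F * D G := by
  induction F using GFun.left_induction with
  | hbase f => exact hbase f G
  | hmom i F hF => rw [mul_assoc, hmom, hF, hmom, map_mul, map_mul]; noncomm_ring
  | hodd s F hF => rw [mul_assoc, hodd, hF, hodd, map_mul, map_mul]; noncomm_ring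
  | hadd F F' hF hF' => rw [add_mul, map_add, hF, hF', map_add, map_add]; noncomm_ring

/-- A twisted derivation is determined by its values on the coordinates and on the functions
of the degree 0 coordinates. -/
theorem leibniz_ext [Finite S] [DecidableEq S] {A : Type*} [Ring A] [Algebra ℝ A]
    {D D' : GFun U S →ₗ[ℝ] A} {σ φ : GFun U S → A}
    (hD : ∀ F G, D (F * G) = D F * φ G + σ F * D G)
    (hD' : ∀ F G, D' (F * G) = D' F * φ G + σ F * D' G)
    (hbase : ∀ f, D (base f) = D' (base f)) (hmom : ∀ i, D (mom i) = D' (mom i))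
    (hodd : ∀ s, D (odd s) = D' (odd s)) : D = D' := by
  refine LinearMap.ext fun F => ?_
  induction F using GFun.mul_induction with
  | hbase f => exact hbase f
  | hmom i => exact hmom i
  | hodd s => exact hodd s
  | hmul F G hF hG => rw [hD, hD', hF, hG]
  | hadd F G hF hG => rw [map_add, map_add, hF, hG]

/-! ### The coordinate vector fields -/

theorem partialX_mul [DecidableEq I] (i : I) (f g : SmoothFun U) :
    partialX U i (f * g) = partialX U i f * g + f * partialX U i g := by
  ext x
  have h : extendZero (f * g).1 =ᶠ[nhds x.1] extendZero f.1 * extendZero g.1 := by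
    filter_upwards [U.isOpen.mem_nhds x.2] with y hy
    simp [extendZero_apply _ (show y ∈ U from hy)]
  change fderiv ℝ (extendZero (f * g).1) x.1 (Pi.single i 1)
    = fderiv ℝ (extendZero f.1) x.1 (Pi.single i 1) * g.1 x
      + f.1 x * fderiv ℝ (extendZero g.1) x.1 (Pi.single i 1)
  rw [h.fderiv_eq, fderiv_mul (SmoothFun.differentiable_extend f x)
    (SmoothFun.differentiable_extend g x), add_apply,
    smul_apply, smul_apply, extendZero_apply _ x.2,
    extendZero_apply _ x.2, smul_eq_mul, smul_eq_mul]
  ring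

theorem partialX_one [DecidableEq I] (i : I) : partialX U i 1 = 0 := by
  have := partialX_mul (U := U) i 1 1
  rwa [one_mul, mul_one, one_mul, left_eq_add] at this

theorem dX_pureFun [DecidableEq I] (i : I) (f : SmoothFun U) (q : MvPolynomial I ℝ)
    (w : ExteriorAlgebra ℝ (S → ℝ)) :
    dX i (pureFun f q w) = pureFun (partialX U i f) q w := rfl

theorem dP_pureFun (i : I) (f : SmoothFun U) (q : MvPolynomial I ℝ)
    (w : ExteriorAlgebra ℝ (S → ℝ)) :
    dP i (pureFun f q w) = pureFun f (MvPolynomial.pderiv i q) w := rfl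

theorem dOdd_pureFun (s : S) (f : SmoothFun U) (q : MvPolynomial I ℝ)
    (w : ExteriorAlgebra ℝ (S → ℝ)) :
    dOdd s (pureFun f q w) = pureFun f q (CliffordAlgebra.contractLeft
      (Q := (0 : QuadraticForm ℝ (S → ℝ))) (LinearMap.proj s : (S → ℝ) →ₗ[ℝ] ℝ) w) := rfl

theorem pureFun_zero_left (q : MvPolynomial I ℝ) (w : ExteriorAlgebra ℝ (S → ℝ)) :
    pureFun (0 : SmoothFun U) q w = 0 := TensorProduct.zero_tmul _ _

theorem pureFun_zero_mid (f : SmoothFun U) (w : ExteriorAlgebra ℝ (S → ℝ)) :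
    pureFun f 0 w = 0 := by
  rw [← zero_smul ℝ (0 : MvPolynomial I ℝ), pureFun_smul_mid, zero_smul, pureFun_zero_left]

theorem pureFun_zero_right (f : SmoothFun U) (q : MvPolynomial I ℝ) :
    pureFun f q (0 : ExteriorAlgebra ℝ (S → ℝ)) = 0 := by
  rw [← zero_smul ℝ (0 : ExteriorAlgebra ℝ (S → ℝ)), pureFun_smul_right, zero_smul,
    pureFun_zero_left]

theorem dX_base [DecidableEq I] (i : I) (f : SmoothFun U) :
    dX i (base f : GFun U S) = base (partialX U i f) := rfl

theorem dX_mom [DecidableEq I] (i j : I) : dX i (mom j : GFun U S) = 0 := by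
  rw [mom_eq, dX_pureFun, partialX_one, pureFun_zero_left]

theorem dX_odd [DecidableEq I] [DecidableEq S] (i : I) (s : S) : dX i (odd s : GFun U S) = 0 := by
  rw [odd_eq, dX_pureFun, partialX_one, pureFun_zero_left]

theorem dP_base (i : I) (f : SmoothFun U) : dP i (base f : GFun U S) = 0 := by
  rw [base_eq, dP_pureFun, MvPolynomial.pderiv_one, pureFun_zero_mid]

theorem dP_mom [DecidableEq I] (i j : I) :
    dP i (mom j : GFun U S) = if i = j then 1 else 0 := by
  rw [mom_eq, dP_pureFun, MvPolynomial.pderiv_X]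
  split_ifs with h
  · subst h; rw [Pi.single_eq_same]; rfl
  · rw [Pi.single_eq_of_ne' h, pureFun_zero_mid]

theorem dP_odd [DecidableEq S] (i : I) (s : S) : dP i (odd s : GFun U S) = 0 := by
  rw [odd_eq, dP_pureFun, MvPolynomial.pderiv_one, pureFun_zero_mid]

theorem dOdd_base (s : S) (f : SmoothFun U) : dOdd s (base f : GFun U S) = 0 := by
  rw [base_eq, dOdd_pureFun]
  exact (congrArg _ (CliffordAlgebra.contractLeft_one _ _)).trans (pureFun_zero_right _ _)

theorem dOdd_mom (s : S) (i : I) : dOdd s (mom i : GFun U S) = 0 := by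
  rw [mom_eq, dOdd_pureFun]
  exact (congrArg _ (CliffordAlgebra.contractLeft_one _ _)).trans (pureFun_zero_right _ _)

theorem dOdd_odd [DecidableEq S] (s t : S) :
    dOdd s (odd t : GFun U S) = if s = t then 1 else 0 := by
  rw [odd_eq, dOdd_pureFun]
  refine (congrArg _ (CliffordAlgebra.contractLeft_ι _ _ _)).trans ?_
  rw [LinearMap.proj_apply, Pi.single_apply]
  split_ifs
  · rw [map_one]; rfl
  · rw [map_zero, pureFun_zero_right]

variable [Finite S] [DecidableEq S]

theorem dX_mul [DecidableEq I] (i : I) (F G : GFun U S) :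
    dX i (F * G) = dX i F * G + F * dX i G := by
  refine leibniz_of_generators (D := dX i) (σ := AlgHom.id ℝ _) (φ := AlgHom.id ℝ _)
    (fun f G => ?_) (fun j G => ?_) (fun s G => ?_) F G
  all_goals
    induction G using GFun.pureFun_induction with
    | hpure f' q w =>
      simp only [AlgHom.id_apply, base_eq, mom_eq, odd_eq, pureFun_mul,
        dX_pureFun, partialX_mul, pureFun_add_left, partialX_one,
        pureFun_zero_left, zero_mul, zero_add, one_mul]
    | hadd F G hF hG => simp only [mul_add, map_add, hF, hG]; abel

theorem dP_mul (i : I) (F G : GFun U S) : dP i (F * G) = dP i F * G + F * dP i G := by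
  classical
  refine leibniz_of_generators (D := dP i) (σ := AlgHom.id ℝ _) (φ := AlgHom.id ℝ _)
    (fun f G => ?_) (fun j G => ?_) (fun s G => ?_) F G
  all_goals
    induction G using GFun.pureFun_induction with
    | hpure f' q w =>
      simp only [AlgHom.id_apply, base_eq, mom_eq, odd_eq, pureFun_mul,
        dP_pureFun, Derivation.leibniz, smul_eq_mul, pureFun_add_mid, MvPolynomial.pderiv_one,
        pureFun_zero_mid, zero_mul, zero_add, one_mul]
      try rw [add_comm, mul_comm q]
    | hadd F G hF hG => simp only [mul_add, map_add, hF, hG]; abel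

theorem dOdd_mul (s : S) (F G : GFun U S) :
    dOdd s (F * G) = dOdd s F * G + parity F * dOdd s G := by
  refine leibniz_of_generators (D := dOdd s) (σ := parity) (φ := AlgHom.id ℝ _)
    (fun f G => ?_) (fun j G => ?_) (fun t G => ?_) F G
  · induction G using GFun.pureFun_induction with
    | hpure f' q w =>
      rw [dOdd_base, parity_base, zero_mul, zero_add, base_eq, pureFun_mul, dOdd_pureFun,
        dOdd_pureFun, pureFun_mul, one_mul, one_mul, one_mul]
    | hadd F G hF hG => simp only [mul_add, map_add, hF, hG]; abel
  · induction G using GFun.pureFun_induction with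
    | hpure f' q w =>
      rw [dOdd_mom, parity_mom, zero_mul, zero_add, mom_eq, pureFun_mul, dOdd_pureFun,
        dOdd_pureFun, pureFun_mul, one_mul, one_mul, one_mul]
    | hadd F G hF hG => simp only [mul_add, map_add, hF, hG]; abel
  · induction G using GFun.pureFun_induction with
    | hpure f' q w =>
      rw [dOdd_odd, parity_odd, AlgHom.id_apply, odd_eq, pureFun_mul, dOdd_pureFun, dOdd_pureFun,
        neg_mul, pureFun_mul, one_mul, one_mul]
      refine (congrArg (pureFun f' q) (CliffordAlgebra.contractLeft_ι_mul _ _ _)).trans ?_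
      rw [sub_eq_add_neg, ← neg_one_smul ℝ (_ * _), pureFun_add_right, pureFun_smul_right,
        pureFun_smul_right, pureFun_smul_left, pureFun_smul_left, neg_one_smul, LinearMap.proj_apply,
        Pi.single_apply, ite_smul, ite_mul, one_smul, zero_smul, one_mul, zero_mul]
    | hadd F G hF hG => simp only [mul_add, map_add, hF, hG]; abel

/-! ### Degrees and commutation relations of the coordinate vector fields -/

theorem dX_mem_homog [DecidableEq I] (i : I) {k : ℕ} {F : GFun U S} (hF : F ∈ homog U S k) :
    dX i F ∈ homog U S k := by
  refine homog_induction (C := fun k F => dX i F ∈ homog U S k) ?_ ?_ ?_ ?_ ?_ ?_ hF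
  · intro f; exact base_mem_homog _
  · intro j k F h; rw [dX_mul, dX_mom, zero_mul, zero_add, add_comm]
    exact homog_mul (mom_mem_homog j) h
  · intro j k F h; rw [dX_mul, dX_odd, zero_mul, zero_add, add_comm]
    exact homog_mul (odd_mem_homog j) h
  · simp
  · intro k F G h1 h2; rw [map_add]; exact add_mem h1 h2
  · intro k r F h; rw [map_smul]; exact Submodule.smul_mem _ _ h

/-- The subtraction `k - 2` is truncated, so the membership is weaker than intended for `k < 2`; the
second conjunct supplies the missing vanishing. The induction also carries `F ∈ homog U S k`,
because the Leibniz rule for `p_j F` produces `F` itself. -/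
theorem dP_mem_homog (i : I) {k : ℕ} {F : GFun U S} (hF : F ∈ homog U S k) :
    dP i F ∈ homog U S (k - 2) ∧ (k < 2 → dP i F = 0) := by
  classical
  refine (homog_induction (C := fun k F => F ∈ homog U S k ∧
    dP i F ∈ homog U S (k - 2) ∧ (k < 2 → dP i F = 0)) ?_ ?_ ?_ ?_ ?_ ?_ hF).2
  · intro f; rw [dP_base]; exact ⟨base_mem_homog f, by simp⟩
  · intro j k F ⟨h0, h, h'⟩
    refine ⟨add_comm 2 k ▸ homog_mul (mom_mem_homog j) h0, ?_, fun hk => by omega⟩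
    rw [dP_mul, dP_mom, Nat.add_sub_cancel]
    refine add_mem ?_ ?_
    · split_ifs
      · rwa [one_mul]
      · simp
    · by_cases hk : k < 2
      · rw [h' hk]; simp
      · have := homog_mul (mom_mem_homog j) h
        rwa [show 2 + (k - 2) = k by omega] at this
  · intro s k F ⟨h0, h, h'⟩
    rw [dP_mul, dP_odd, zero_mul, zero_add]
    refine ⟨add_comm 1 k ▸ homog_mul (odd_mem_homog s) h0, ?_,
      fun hk => by rw [h' (by omega), mul_zero]⟩
    by_cases hk : k < 2
    · rw [h' hk]; simp
    · have := homog_mul (odd_mem_homog s) h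
      rwa [show 1 + (k - 2) = k + 1 - 2 by omega] at this
  · simp
  · intro k F G ⟨h0, h1, h1'⟩ ⟨h3, h2, h2'⟩
    rw [map_add]
    exact ⟨add_mem h0 h3, add_mem h1 h2, fun h => by rw [h1' h, h2' h, add_zero]⟩
  · intro k r F ⟨h0, h, h'⟩
    rw [map_smul]
    exact ⟨Submodule.smul_mem _ _ h0, Submodule.smul_mem _ _ h, fun hk => by rw [h' hk, smul_zero]⟩

theorem dOdd_mem_homog (s : S) {k : ℕ} {F : GFun U S} (hF : F ∈ homog U S k) :
    dOdd s F ∈ homog U S (k - 1) ∧ (k < 1 → dOdd s F = 0) := by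
  refine (homog_induction (C := fun k F => F ∈ homog U S k ∧
    dOdd s F ∈ homog U S (k - 1) ∧ (k < 1 → dOdd s F = 0)) ?_ ?_ ?_ ?_ ?_ ?_ hF).2
  · intro f; rw [dOdd_base]; exact ⟨base_mem_homog f, by simp⟩
  · intro j k F ⟨h0, h, h'⟩
    refine ⟨add_comm 2 k ▸ homog_mul (mom_mem_homog j) h0, ?_, fun hk => by omega⟩
    rw [dOdd_mul, dOdd_mom, zero_mul, zero_add, parity_mom]
    by_cases hk : k < 1
    · rw [h' hk]; simp
    · have := homog_mul (mom_mem_homog j) h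
      rwa [show 2 + (k - 1) = k + 2 - 1 by omega] at this
  · intro t k F ⟨h0, h, h'⟩
    refine ⟨add_comm 1 k ▸ homog_mul (odd_mem_homog t) h0, ?_, fun hk => by omega⟩
    rw [dOdd_mul, dOdd_odd, parity_odd, Nat.add_sub_cancel]
    refine add_mem ?_ ?_
    · split_ifs
      · rwa [one_mul]
      · simp
    · by_cases hk : k < 1
      · rw [h' hk]; simp
      · have := homog_mul (neg_mem (odd_mem_homog t)) h
        rwa [show 1 + (k - 1) = k by omega] at this
  · simp
  · intro k F G ⟨h0, h1, h1'⟩ ⟨h3, h2, h2'⟩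
    rw [map_add]
    exact ⟨add_mem h0 h3, add_mem h1 h2, fun h => by rw [h1' h, h2' h, add_zero]⟩
  · intro k r F ⟨h0, h, h'⟩
    rw [map_smul]
    exact ⟨Submodule.smul_mem _ _ h0, Submodule.smul_mem _ _ h, fun hk => by rw [h' hk, smul_zero]⟩

omit [Finite S] [DecidableEq S] in
theorem dX_dOdd [DecidableEq I] (i : I) (s : S) (F : GFun U S) :
    dX i (dOdd s F) = dOdd s (dX i F) := by
  induction F using GFun.pureFun_induction with
  | hpure f q w => rw [dOdd_pureFun, dX_pureFun, dX_pureFun, dOdd_pureFun]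
  | hadd F G hF hG => simp only [map_add, hF, hG]

/-! ### Functions of low degree -/

/-- A function of degree 3 all of whose derivatives in the odd directions vanish is zero. -/
theorem eq_zero_of_dOdd_eq_zero {F : GFun U S} (hF : F ∈ homog U S 3)
    (h : ∀ s, dOdd s F = 0) : F = 0 := by
  have := Fintype.ofFinite S
  -- The Euler operator in the odd directions: it multiplies a monomial by its number of odd
  -- factors.
  let E : Module.End ℝ (GFun U S) := ∑ s, LinearMap.mulLeft ℝ (odd s) ∘ₗ dOdd s
  have hE : ∀ F, E F = ∑ s, odd s * dOdd s F := fun F => by simp [E, LinearMap.sum_apply]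
  have hEmom : ∀ i F, E (mom i * F) = mom i * E F := fun i F => by
    rw [hE, hE, Finset.mul_sum]
    refine Finset.sum_congr rfl fun s _ => ?_
    rw [dOdd_mul, dOdd_mom, zero_mul, zero_add, parity_mom, ← mul_assoc, ← mul_assoc, mom_mul_comm]
  have hEodd : ∀ s F, E (odd s * F) = odd s * (E F + F) := fun s F => by
    rw [hE, hE, mul_add, Finset.mul_sum]
    simp only [dOdd_mul, dOdd_odd, parity_odd, mul_add, Finset.sum_add_distrib, ite_mul, one_mul,
      zero_mul, mul_ite, mul_zero]
    rw [Finset.sum_ite_eq' Finset.univ s, if_pos (Finset.mem_univ _), add_comm]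
    congr 1
    refine Finset.sum_congr rfl fun t _ => ?_
    rw [neg_mul, mul_neg, ← mul_assoc, odd_mul_odd, neg_mul, neg_neg, mul_assoc]
  -- The possible numbers of odd factors are 0 in degree 0, 1 in degree 1, 0 or 2 in degree 2, and 1
  -- or 3 in degree 3. The identities are the resulting annihilating polynomials of `E`, the last
  -- being `(E - 1)(E - 3) = 0`; its constant term 3 is nonzero, so `E F = 0` forces `F = 0`.
  have key := homog_induction (C := fun k F => (k = 0 → E F = 0) ∧ (k = 1 → E F = F) ∧
    (k = 2 → E (E F) = (2 : ℝ) • E F) ∧ (k = 3 → E (E F) = (4 : ℝ) • E F - (3 : ℝ) • F))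
    ?_ ?_ ?_ ?_ ?_ ?_ hF
  · have h0 : E F = 0 := by rw [hE]; exact Finset.sum_eq_zero fun s _ => by rw [h, mul_zero]
    have := key.2.2.2 rfl
    rw [h0, map_zero, smul_zero, zero_sub, eq_comm, neg_eq_zero] at this
    exact (smul_eq_zero.1 this).resolve_left (by norm_num)
  · intro f
    refine ⟨fun _ => ?_, by omega, by omega, by omega⟩
    rw [hE]; exact Finset.sum_eq_zero fun s _ => by rw [dOdd_base, mul_zero]
  · intro i k F ⟨h0, h1, _, _⟩
    refine ⟨by omega, by omega, fun hk => ?_, fun hk => ?_⟩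
    · rw [hEmom, h0 (by omega), mul_zero, map_zero, smul_zero]
    · rw [hEmom, h1 (by omega), hEmom, h1 (by omega), ← sub_smul]; norm_num
  · intro s k F ⟨h0, h1, h2, _⟩
    refine ⟨by omega, fun hk => ?_, fun hk => ?_, fun hk => ?_⟩
    · rw [hEodd, h0 (by omega), zero_add]
    · rw [hEodd, h1 (by omega), hEodd, map_add, h1 (by omega), ← mul_smul_comm, two_smul]
    · rw [hEodd, hEodd, map_add, h2 (by omega), ← mul_smul_comm, ← mul_smul_comm, ← mul_sub]
      congr 1
      module
  · intro k; simp
  · intro k F G ⟨a0, a1, a2, a3⟩ ⟨b0, b1, b2, b3⟩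
    simp only [map_add]
    refine ⟨fun hk => ?_, fun hk => ?_, fun hk => ?_, fun hk => ?_⟩
    · rw [a0 hk, b0 hk, add_zero]
    · rw [a1 hk, b1 hk]
    · rw [a2 hk, b2 hk, smul_add]
    · rw [a3 hk, b3 hk]; module
  · intro k r F ⟨a0, a1, a2, a3⟩
    simp only [map_smul]
    refine ⟨fun hk => ?_, fun hk => ?_, fun hk => ?_, fun hk => ?_⟩
    · rw [a0 hk, smul_zero]
    · rw [a1 hk]
    · rw [a2 hk, smul_comm]
    · rw [a3 hk]; module

/-- Normal forms in degrees 0, 1 and 2, proved together because each is obtained from a lower one by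
multiplying by a coordinate. The coefficients `h s t` are not required to be antisymmetric and hence
are not unique. -/
theorem exists_of_mem_homog [Fintype S] [DecidableEq I] {k : ℕ} {F : GFun U S}
    (hF : F ∈ homog U S k) :
    (k = 0 → ∃ f, F = base f) ∧ (k = 1 → ∃ f : S → SmoothFun U, F = ∑ s, base (f s) * odd s) ∧
    (k = 2 → ∃ (f : I → SmoothFun U) (h : S → S → SmoothFun U),
      F = ∑ i, base (f i) * mom i + ∑ s, ∑ t, base (h s t) * odd s * odd t) := by
  refine homog_induction (C := fun k F => (k = 0 → ∃ f, F = base f) ∧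
    (k = 1 → ∃ f : S → SmoothFun U, F = ∑ s, base (f s) * odd s) ∧
    (k = 2 → ∃ (f : I → SmoothFun U) (h : S → S → SmoothFun U),
      F = ∑ i, base (f i) * mom i + ∑ s, ∑ t, base (h s t) * odd s * odd t)) ?_ ?_ ?_ ?_ ?_ ?_ hF
  · intro f; exact ⟨fun _ => ⟨f, rfl⟩, by omega, by omega⟩
  · rintro i k F ⟨h, -, -⟩
    refine ⟨by omega, by omega, fun hk => ?_⟩
    obtain ⟨f, rfl⟩ := h (by omega)
    refine ⟨Pi.single i f, 0, ?_⟩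
    rw [mom_mul_comm]
    simp [Pi.single_apply, apply_ite base, base_zero, ite_mul]
  · rintro s k F ⟨h0, h1, -⟩
    refine ⟨by omega, fun hk => ?_, fun hk => ?_⟩
    · obtain ⟨f, rfl⟩ := h0 (by omega)
      refine ⟨Pi.single s f, ?_⟩
      rw [← base_mul_comm]
      simp [Pi.single_apply, apply_ite base, base_zero, ite_mul]
    · obtain ⟨f, rfl⟩ := h1 (by omega)
      refine ⟨0, Pi.single s f, ?_⟩
      have h : ∀ u t, (base (Pi.single (M := fun _ => S → SmoothFun U) s f u t) : GFun U S)
          = if u = s then base (f t) else 0 := by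
        intro u t
        rw [Pi.single_apply]
        split_ifs
        · rfl
        · exact base_zero
      simp only [h, ite_mul, zero_mul, Finset.mul_sum, Pi.zero_apply, base_zero,
        Finset.sum_const_zero, zero_add]
      rw [Finset.sum_comm]
      refine Finset.sum_congr rfl fun t _ => ?_
      rw [Finset.sum_ite_eq' Finset.univ s, if_pos (Finset.mem_univ _), ← mul_assoc, base_mul_comm]
  · intro k
    exact ⟨fun _ => ⟨0, base_zero.symm⟩, fun _ => ⟨0, by simp [base_zero]⟩,
      fun _ => ⟨0, 0, by simp [base_zero]⟩⟩
  · intro k F G ⟨a0, a1, a2⟩ ⟨b0, b1, b2⟩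
    refine ⟨fun hk => ?_, fun hk => ?_, fun hk => ?_⟩
    · obtain ⟨f, rfl⟩ := a0 hk; obtain ⟨f', rfl⟩ := b0 hk
      exact ⟨f + f', (base_add _ _).symm⟩
    · obtain ⟨f, rfl⟩ := a1 hk; obtain ⟨f', rfl⟩ := b1 hk
      exact ⟨f + f', by simp only [Pi.add_apply, base_add, add_mul, Finset.sum_add_distrib]⟩
    · obtain ⟨f, h, rfl⟩ := a2 hk; obtain ⟨f', h', rfl⟩ := b2 hk
      refine ⟨f + f', h + h', ?_⟩
      simp only [Pi.add_apply, base_add, add_mul, Finset.sum_add_distrib]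
      abel
  · intro k r F ⟨a0, a1, a2⟩
    refine ⟨fun hk => ?_, fun hk => ?_, fun hk => ?_⟩
    · obtain ⟨f, rfl⟩ := a0 hk
      exact ⟨r • f, (base_smul _ _).symm⟩
    · obtain ⟨f, rfl⟩ := a1 hk
      exact ⟨r • f, by simp only [Pi.smul_apply, base_smul, smul_mul_assoc, Finset.smul_sum]⟩
    · obtain ⟨f, h, rfl⟩ := a2 hk
      refine ⟨r • f, r • h, ?_⟩
      simp only [Pi.smul_apply, base_smul, smul_mul_assoc, Finset.smul_sum, smul_add]

-- Setting `p = 0` and `θ = 0` is a left inverse of `base`. This turns identities between functions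
-- on the graded domain into identities between coefficients.
omit [Finite S] [DecidableEq S] in
theorem base_injective : Function.Injective (base : SmoothFun U → GFun U S) := by
  let aug : MvPolynomial I ℝ ⊗[ℝ] ExteriorAlgebra ℝ (S → ℝ) →ₐ[ℝ] ℝ :=
    Algebra.TensorProduct.lift (MvPolynomial.aeval 0) ExteriorAlgebra.algebraMapInv
      fun _ _ => mul_comm _ _
  let r : GFunTensor U S →ₗ[ℝ] SmoothFun U :=
    (TensorProduct.rid ℝ (SmoothFun U)).toLinearMap ∘ₗ LinearMap.lTensor _ aug.toLinearMap
  refine Function.LeftInverse.injective (g := r) fun f => ?_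
  change TensorProduct.rid ℝ (SmoothFun U) (f ⊗ₜ[ℝ] aug 1) = f
  rw [map_one, TensorProduct.rid_tmul, one_smul]

/-! ### Vector fields -/

omit [Finite S] in
theorem IsVectorField.zero (k : ℕ) : IsVectorField k (0 : Module.End ℝ (GFun U S)) :=
  ⟨fun j F _ => by simp, fun F G => by simp⟩

omit [Finite S] in
theorem IsVectorField.add {k : ℕ} {D D' : Module.End ℝ (GFun U S)} (h : IsVectorField k D)
    (h' : IsVectorField k D') : IsVectorField k (D + D') :=
  ⟨fun j F hF => add_mem (h.degree j F hF) (h'.degree j F hF), fun F G => by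
    simp only [LinearMap.add_apply, h.leibniz, h'.leibniz]; noncomm_ring⟩

omit [Finite S] in
theorem IsVectorField.sum {k : ℕ} {κ : Type*} (s : Finset κ) {D : κ → Module.End ℝ (GFun U S)}
    (h : ∀ i, IsVectorField k (D i)) : IsVectorField k (∑ i ∈ s, D i) := by
  classical
  induction s using Finset.induction_on with
  | empty => exact IsVectorField.zero k
  | insert a s ha ih => rw [Finset.sum_insert ha]; exact (h a).add ih

theorem parity_iterate_add_two (k : ℕ) (F : GFun U S) : (parity^[k + 2]) F = (parity^[k]) F := by
  rw [Function.iterate_succ_apply', Function.iterate_succ_apply', parity_parity]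

theorem isVectorField_mul_dX [DecidableEq I] {k : ℕ} {A : GFun U S} (hA : A ∈ homog U S k)
    (i : I) : IsVectorField k (LinearMap.mulLeft ℝ A ∘ₗ dX i) where
  degree j F hF := add_comm k j ▸ homog_mul hA (dX_mem_homog i hF)
  leibniz F G := by
    simp only [LinearMap.comp_apply, LinearMap.mulLeft_apply]
    rw [dX_mul, mul_add, ← mul_assoc, ← mul_assoc, homog_mul_comm hA F, mul_assoc _ A]

theorem isVectorField_mul_dP {k : ℕ} {A : GFun U S} (hA : A ∈ homog U S (k + 2))
    (i : I) : IsVectorField k (LinearMap.mulLeft ℝ A ∘ₗ dP i) where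
  degree j F hF := by
    simp only [LinearMap.comp_apply, LinearMap.mulLeft_apply]
    by_cases hj : j < 2
    · rw [(dP_mem_homog i hF).2 hj]; simp
    · have := homog_mul hA (dP_mem_homog i hF).1
      rwa [show k + 2 + (j - 2) = j + k by omega] at this
  leibniz F G := by
    simp only [LinearMap.comp_apply, LinearMap.mulLeft_apply]
    rw [dP_mul, mul_add, ← mul_assoc, ← mul_assoc, homog_mul_comm hA F, mul_assoc _ A,
      parity_iterate_add_two]

theorem isVectorField_mul_dOdd {k : ℕ} {A : GFun U S} (hA : A ∈ homog U S (k + 1))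
    (s : S) : IsVectorField k (LinearMap.mulLeft ℝ A ∘ₗ dOdd s) where
  degree j F hF := by
    simp only [LinearMap.comp_apply, LinearMap.mulLeft_apply]
    by_cases hj : j < 1
    · rw [(dOdd_mem_homog s hF).2 hj]; simp
    · have := homog_mul hA (dOdd_mem_homog s hF).1
      rwa [show k + 1 + (j - 1) = j + k by omega] at this
  leibniz F G := by
    simp only [LinearMap.comp_apply, LinearMap.mulLeft_apply]
    -- One parity comes from the odd derivative and `k + 1` from moving `F` past `A`; two of these
    -- cancel, leaving the `k` that the Leibniz rule demands.
    rw [dOdd_mul, mul_add, ← mul_assoc, ← mul_assoc, homog_mul_comm hA (parity F), mul_assoc _ A,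
      ← Function.iterate_succ_apply, parity_iterate_add_two]

theorem IsVectorField.ext {k : ℕ} {D D' : Module.End ℝ (GFun U S)} (h : IsVectorField k D)
    (h' : IsVectorField k D') (hbase : ∀ f, D (base f) = D' (base f))
    (hmom : ∀ i, D (mom i) = D' (mom i)) (hodd : ∀ s, D (odd s) = D' (odd s)) : D = D' :=
  leibniz_ext h.leibniz h'.leibniz hbase hmom hodd

/-- On a homogeneous function parity is the sign of its degree, and `D` raises the degree by one.
This sign makes the cross terms cancel in the Leibniz rule for `D²`. -/
theorem IsVectorField.comm_parity {D : Module.End ℝ (GFun U S)} (h : IsVectorField 1 D)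
    (F : GFun U S) : D (parity F) = -parity (D F) := by
  induction F using GFun.homog_sum_induction with
  | hhom k F hF =>
    rw [parity_homog hF, parity_homog (h.degree k F hF), map_smul, pow_succ, mul_neg_one, neg_smul,
      neg_neg]
  | hadd F G hF hG => simp only [map_add, hF, hG, neg_add]

/-- The square of a vector field of degree 1 is a vector field of degree 2. -/
theorem IsVectorField.sq {D : Module.End ℝ (GFun U S)} (h : IsVectorField 1 D) :
    IsVectorField 2 (D ∘ₗ D) where
  degree j F hF := h.degree _ _ (h.degree j F hF)
  leibniz F G := by
    simp only [LinearMap.comp_apply]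
    rw [h.leibniz, map_add, h.leibniz, h.leibniz]
    simp only [Function.iterate_succ_apply, Function.iterate_zero_apply, h.comm_parity]
    noncomm_ring

end Derivations

/-! ### Vector fields with prescribed components. -/

section CoordinateFields

variable {I : Type*} [Fintype I] [DecidableEq I] {U : Opens (I → ℝ)}
  {S : Type*} [Fintype S] [DecidableEq S]

/-- The vector field `A_i ∂/∂x^i + B_i ∂/∂p_i + C_s ∂/∂θ^s`. -/
noncomputable def coordField (A B : I → GFun U S) (C : S → GFun U S) : Module.End ℝ (GFun U S) :=
  ∑ i, LinearMap.mulLeft ℝ (A i) ∘ₗ dX i + ∑ i, LinearMap.mulLeft ℝ (B i) ∘ₗ dP i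
    + ∑ s, LinearMap.mulLeft ℝ (C s) ∘ₗ dOdd s

theorem coordField_apply (A B : I → GFun U S) (C : S → GFun U S) (F : GFun U S) :
    coordField A B C F = ∑ i, A i * dX i F + ∑ i, B i * dP i F + ∑ s, C s * dOdd s F := by
  simp [coordField, LinearMap.sum_apply]

theorem isVectorField_coordField {k : ℕ} {A B : I → GFun U S} {C : S → GFun U S}
    (hA : ∀ i, A i ∈ homog U S k) (hB : ∀ i, B i ∈ homog U S (k + 2))
    (hC : ∀ s, C s ∈ homog U S (k + 1)) : IsVectorField k (coordField A B C) :=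
  ((IsVectorField.sum _ fun i => isVectorField_mul_dX (hA i) i).add
    (IsVectorField.sum _ fun i => isVectorField_mul_dP (hB i) i)).add
    (IsVectorField.sum _ fun s => isVectorField_mul_dOdd (hC s) s)

theorem coordField_base (A B : I → GFun U S) (C : S → GFun U S) (f : SmoothFun U) :
    coordField A B C (base f) = ∑ i, A i * base (partialX U i f) := by
  simp [coordField_apply, dX_base, dP_base, dOdd_base]

theorem coordField_mom (A B : I → GFun U S) (C : S → GFun U S) (i : I) :
    coordField A B C (mom i) = B i := by
  simp [coordField_apply, dX_mom, dP_mom, dOdd_mom]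

theorem coordField_odd (A B : I → GFun U S) (C : S → GFun U S) (s : S) :
    coordField A B C (odd s) = C s := by
  simp [coordField_apply, dX_odd, dP_odd, dOdd_odd]

end CoordinateFields

/-! ### The Poisson bracket, the Hamiltonian and the structure functions. -/

section Hamiltonian

variable {I P N : Type*} [Fintype I] [Fintype P] [Fintype N]
  [DecidableEq I] [DecidableEq P] [DecidableEq N] {U : Opens (I → ℝ)}

theorem fullMetric_isSymm {g : Matrix P P ℝ} {g' : Matrix N N ℝ} (hg : g.IsSymm)
    (hg' : g'.IsSymm) : (fullMetric g g').IsSymm :=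
  Matrix.IsSymm.fromBlocks hg Matrix.transpose_zero hg'

theorem fullMetric_isUnit_det {g : Matrix P P ℝ} {g' : Matrix N N ℝ} (hg : IsUnit g.det)
    (hg' : IsUnit g'.det) : IsUnit (fullMetric g g').det := by
  rw [fullMetric, Matrix.det_fromBlocks_zero₂₁]
  exact hg.mul hg'

theorem fullMetric_inv {g : Matrix P P ℝ} {g' : Matrix N N ℝ} (hg : IsUnit g.det)
    (hg' : IsUnit g'.det) : (fullMetric g g')⁻¹ = Matrix.fromBlocks g⁻¹ 0 0 g'⁻¹ := by
  refine Matrix.inv_eq_right_inv ?_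
  rw [fullMetric, Matrix.fromBlocks_multiply]
  simp [Matrix.mul_nonsing_inv _ hg, Matrix.mul_nonsing_inv _ hg']

variable {G : Matrix (P ⊕ N) (P ⊕ N) ℝ}

/-- Exhibits `{F, ·}` as a coordinate vector field, so that its Leibniz rule, degree and values on
generators come from the general results. -/
theorem poisson_eq_coordField (F K : FunE U P N) :
    poisson G F K = coordField (fun i => dP i F) (fun i => -dX i F)
      (fun β => ∑ α, G⁻¹ α β • parity (dOdd α F)) K := by
  rw [coordField_apply, poisson]
  simp only [Finset.sum_sub_distrib, neg_mul, Finset.sum_neg_distrib, ← sub_eq_add_neg,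
    Finset.sum_mul, smul_mul_assoc]
  congr 1
  exact Finset.sum_comm

theorem poisson_base (F : FunE U P N) (f : SmoothFun U) :
    poisson G F (base f) = ∑ i, dP i F * base (partialX U i f) := by
  rw [poisson_eq_coordField, coordField_base]

theorem poisson_mom (F : FunE U P N) (i : I) : poisson G F (mom i) = -dX i F := by
  rw [poisson_eq_coordField, coordField_mom]

theorem poisson_odd (F : FunE U P N) (β : P ⊕ N) :
    poisson G F (odd β) = ∑ α, G⁻¹ α β • parity (dOdd α F) := by
  rw [poisson_eq_coordField, coordField_odd]

theorem odd_poisson (α : P ⊕ N) (K : FunE U P N) :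
    poisson G (odd α) K = ∑ β, G⁻¹ α β • dOdd β K := by
  simp only [poisson, dP_odd, dX_odd, dOdd_odd, zero_mul, sub_zero, Finset.sum_const_zero, zero_add]
  rw [Finset.sum_eq_single α]
  · simp
  · intro β _ h; simp [h]
  · simp

/-- The Poisson bracket with a fixed first entry, as a linear map. -/
noncomputable def poissonLeft (G : Matrix (P ⊕ N) (P ⊕ N) ℝ) (F : FunE U P N) :
    Module.End ℝ (FunE U P N) :=
  coordField (fun i => dP i F) (fun i => -dX i F) (fun β => ∑ α, G⁻¹ α β • parity (dOdd α F))

theorem poissonLeft_apply (F K : FunE U P N) : poissonLeft G F K = poisson G F K :=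
  (poisson_eq_coordField F K).symm

theorem parity_mem_homog {S : Type*} [DecidableEq S] {k : ℕ} {F : GFun U S}
    (hF : F ∈ homog U S k) : parity F ∈ homog U S k := by
  rw [parity_homog hF]; exact Submodule.smul_mem _ _ hF

theorem isVectorField_poissonLeft {H : FunE U P N} (hH : H ∈ homog U (P ⊕ N) 3) :
    IsVectorField 1 (poissonLeft G H) :=
  isVectorField_coordField (fun i => (dP_mem_homog i hH).1) (fun i => neg_mem (dX_mem_homog i hH))
    fun _ => sum_mem fun α _ => Submodule.smul_mem _ _ (parity_mem_homog (dOdd_mem_homog α hH).1)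

/-- The coordinate `e_α = G_{αβ} e^β` with lowered index. -/
noncomputable def lowered (G : Matrix (P ⊕ N) (P ⊕ N) ℝ) (α : P ⊕ N) : FunE U P N :=
  ∑ β, G α β • odd β

theorem lowered_mem_homog (α : P ⊕ N) : (lowered G α : FunE U P N) ∈ homog U (P ⊕ N) 1 :=
  sum_mem fun β _ => Submodule.smul_mem _ _ (odd_mem_homog β)

/-- Lowering and then raising an index is the identity, for tensors with values in any real vector
space. -/
theorem sum_smul_sum_smul_of_mul_eq_one {κ M : Type*} [Fintype κ] [DecidableEq κ]
    [AddCommGroup M] [Module ℝ M] {A B : Matrix κ κ ℝ} (h : A * B = 1) (X : κ → M) (k : κ) :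
    ∑ i, A k i • ∑ j, B i j • X j = X k := by
  simp only [Finset.smul_sum, ← mul_smul]
  rw [Finset.sum_comm]
  simp only [← Finset.sum_smul, ← Matrix.mul_apply, h, Matrix.one_apply, ite_smul, one_smul,
    zero_smul]
  simp

theorem odd_eq_sum_lowered (hG : IsUnit G.det) (β : P ⊕ N) :
    (odd β : FunE U P N) = ∑ α, G⁻¹ β α • lowered G α :=
  (sum_smul_sum_smul_of_mul_eq_one (Matrix.nonsing_inv_mul G hG) _ β).symm

theorem poisson_lowered (hG : IsUnit G.det) (hs : G.IsSymm) (F : FunE U P N) (α : P ⊕ N) :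
    poisson G F (lowered G α) = parity (dOdd α F) := by
  have hi : ∀ α β, G⁻¹ α β = G⁻¹ β α := fun α β => by
    conv_lhs => rw [← hs, ← Matrix.transpose_nonsing_inv, Matrix.transpose_apply]
  rw [← poissonLeft_apply, lowered, map_sum]
  simp only [map_smul, poissonLeft_apply, poisson_odd]
  simp only [hi _ (_ : P ⊕ N)]
  exact sum_smul_sum_smul_of_mul_eq_one (Matrix.mul_nonsing_inv G hG)
    (fun α => parity (dOdd α F)) α

theorem lowered_poisson (hG : IsUnit G.det) (K : FunE U P N) (α : P ⊕ N) :
    poisson G (lowered G α) K = dOdd α K := by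
  have hlin : poisson G (lowered G α) K = ∑ β, G α β • poisson G (odd β) K := by
    let L : FunE U P N →ₗ[ℝ] FunE U P N :=
      { toFun := fun F => poisson G F K
        map_add' := fun F F' => by
          simp only [poisson, map_add, add_mul, smul_add, Finset.sum_add_distrib,
            Finset.sum_sub_distrib]
          abel
        map_smul' := fun r F => by
          simp only [poisson, map_smul, smul_mul_assoc, smul_add, Finset.smul_sum, smul_sub,
            RingHom.id_apply]
          simp only [smul_comm r] }
    change L (lowered G α) = ∑ β, G α β • L (odd β)
    rw [lowered, map_sum]
    simp only [map_smul]
  rw [hlin]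
  simp only [odd_poisson]
  exact sum_smul_sum_smul_of_mul_eq_one (Matrix.mul_nonsing_inv G hG) (fun α => dOdd α K) α

/-! ### The Hamiltonian -/

theorem hamiltonian_mem_homog (ρ : P ⊕ N → I → SmoothFun U)
    (c : P ⊕ N → P ⊕ N → P ⊕ N → SmoothFun U) : hamiltonian ρ c ∈ homog U (P ⊕ N) 3 := by
  have h1 : ∀ α i, (base (ρ α i) * mom i * odd α : FunE U P N) ∈ homog U (P ⊕ N) 3 := fun α i => by
    have := homog_mul (homog_mul (base_mem_homog (ρ α i)) (mom_mem_homog i)) (odd_mem_homog α)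
    simpa only [Nat.reduceAdd] using this
  have h2 : ∀ α β γ, (base (c α β γ) * odd α * odd β * odd γ : FunE U P N)
      ∈ homog U (P ⊕ N) 3 := fun α β γ => by
    have := homog_mul (homog_mul (homog_mul (base_mem_homog (c α β γ)) (odd_mem_homog α))
      (odd_mem_homog β)) (odd_mem_homog γ)
    simpa only [Nat.reduceAdd] using this
  rw [hamiltonian]
  refine sub_mem ?_ (Submodule.smul_mem _ _ ?_)
  · exact sum_mem fun α _ => sum_mem fun i _ => h1 α i
  · exact sum_mem fun α _ => sum_mem fun β _ => sum_mem fun γ _ => h2 α β γ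

theorem dP_hamiltonian (ρ : P ⊕ N → I → SmoothFun U)
    (c : P ⊕ N → P ⊕ N → P ⊕ N → SmoothFun U) (i : I) :
    dP i (hamiltonian ρ c) = ∑ α, base (ρ α i) * odd α := by
  simp only [hamiltonian, map_sub, map_sum, map_smul, dP_mul, dP_base, dP_mom, dP_odd, zero_mul,
    mul_zero, zero_add, add_zero, Finset.sum_const_zero, smul_zero, sub_zero]
  simp

/-- By total antisymmetry each of the three slots of the cubic term contributes equally, which turns
`1/6` into `1/2`. -/
theorem dOdd_hamiltonian {ρ : P ⊕ N → I → SmoothFun U}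
    {c : P ⊕ N → P ⊕ N → P ⊕ N → SmoothFun U} (hl : ∀ α β γ, c β α γ = - c α β γ)
    (hr : ∀ α β γ, c α γ β = - c α β γ) (δ : P ⊕ N) :
    dOdd δ (hamiltonian ρ c) = ∑ i, base (ρ δ i) * mom i
      - (1 / 2 : ℝ) • ∑ β, ∑ γ, base (c δ β γ) * odd β * odd γ := by
  have h1 : dOdd δ (∑ α, ∑ i, base (ρ α i) * mom i * odd α : FunE U P N)
      = ∑ i, base (ρ δ i) * mom i := by
    simp only [map_sum, dOdd_mul, dOdd_base, dOdd_mom, dOdd_odd, map_mul, parity_base, parity_mom,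
      zero_mul, mul_zero, zero_add]
    rw [Finset.sum_comm]
    simp
  have h2 : dOdd δ (∑ α, ∑ β, ∑ γ, base (c α β γ) * odd α * odd β * odd γ : FunE U P N)
      = (3 : ℝ) • ∑ β, ∑ γ, base (c δ β γ) * odd β * odd γ := by
    have e1 : ∀ α β γ, dOdd δ (base (c α β γ) * odd α * odd β * odd γ : FunE U P N)
        = (if δ = α then base (c δ β γ) * odd β * odd γ else 0)
          + (if δ = β then base (c δ α γ) * odd α * odd γ else 0)
          + (if δ = γ then base (c δ α β) * odd α * odd β else 0) := by
      intro α β γ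
      simp only [dOdd_mul, dOdd_base, dOdd_odd, map_mul, parity_base, parity_odd, zero_mul,
        zero_add]
      congr 1
      · rw [add_mul]
        congr 1
        · split_ifs with h
          · subst h; rw [mul_one]
          · simp
        · split_ifs with h
          · subst h; rw [hl, base_neg]; noncomm_ring
          · simp
      · split_ifs with h
        · subst h; rw [hr, hl, neg_neg]; noncomm_ring
        · simp
    simp only [map_sum, e1, Finset.sum_add_distrib]
    rw [show (3 : ℝ) = 1 + 1 + 1 by norm_num, add_smul, add_smul, one_smul]
    congr 1
    · congr 1
      · rw [Finset.sum_eq_single δ]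
        · simp
        · intro α _ h; simp [Ne.symm h]
        · simp
      · refine Finset.sum_congr rfl fun α _ => ?_
        rw [Finset.sum_comm]
        simp
    · simp
  rw [hamiltonian, map_sub, h1, map_smul, h2, smul_smul]
  norm_num

theorem dP_dOdd_hamiltonian {ρ : P ⊕ N → I → SmoothFun U}
    {c : P ⊕ N → P ⊕ N → P ⊕ N → SmoothFun U} (hl : ∀ α β γ, c β α γ = - c α β γ)
    (hr : ∀ α β γ, c α γ β = - c α β γ) (δ : P ⊕ N) (i : I) :
    dP i (dOdd δ (hamiltonian ρ c)) = base (ρ δ i) := by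
  simp only [dOdd_hamiltonian hl hr, map_sub, map_sum, map_smul, dP_mul, dP_base, dP_mom, dP_odd]
  simp

/-- Two odd derivatives extract the antisymmetric part of `h`, which is all that the function
determines. -/
theorem dOdd_dOdd_sum {S : Type*} [Fintype S] [DecidableEq S] (f : I → SmoothFun U)
    (h : S → S → SmoothFun U) (β γ : S) :
    dOdd γ (dOdd β (∑ i, base (f i) * mom i + ∑ s, ∑ t, base (h s t) * odd s * odd t))
      = (base (h β γ - h γ β) : GFun U S) := by
  simp only [map_add, map_sum, dOdd_mul, dOdd_base, dOdd_mom, dOdd_odd, parity_base, parity_odd,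
    map_mul, zero_mul, mul_zero, add_zero, zero_add, Finset.sum_add_distrib, mul_ite, ite_mul,
    mul_one, mul_neg, apply_ite (dOdd γ : GFun U S → GFun U S), map_zero, map_neg]
  simp [sub_eq_add_neg, base_add, base_neg]

/-! ### Structure functions -/

/-- This is the symplectic condition for the pair `e_α`, `F`, since `{e_α, ·}` is the derivative by
`e^α`; the minus sign comes from `e_α` being odd. -/
theorem IsHomological.map_lowered_poisson {QE : Module.End ℝ (FunE U P N)}
    (hQ : IsHomological G QE) (hG : IsUnit G.det) (F : FunE U P N) (α : P ⊕ N) :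
    QE (dOdd α F) = poisson G (QE (lowered G α)) F - dOdd α (QE F) := by
  have h1 : ∀ K : FunE U P N, poisson G (-lowered G α) K = -dOdd α K := fun K => by
    rw [← lowered_poisson hG]
    simp only [poisson, map_neg, neg_mul, smul_neg, Finset.sum_neg_distrib,
      Finset.sum_sub_distrib]
    abel
  rw [← lowered_poisson hG, hQ.symplectic, parity_homog (lowered_mem_homog α), pow_one,
    neg_one_smul, h1, sub_eq_add_neg]

theorem IsVectorField.map_one {S : Type*} [DecidableEq S] {k : ℕ} {D : Module.End ℝ (GFun U S)}
    (h : IsVectorField k D) : D 1 = 0 := by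
  have h1 := h.leibniz 1 1
  rwa [Function.iterate_fixed (_root_.map_one parity) k, one_mul, mul_one, one_mul, left_eq_add] at h1

/-- The structure functions of a homological vector field exist. -/
theorem IsHomological.exists_structureFunctions {QE : Module.End ℝ (FunE U P N)}
    (hQ : IsHomological G QE) (hG : IsUnit G.det) (hs : G.IsSymm) :
    ∃ ρ c, IsStructureFunctions G QE ρ c := by
  have hq : ∀ α, QE (lowered G α) ∈ homog U (P ⊕ N) 2 := fun α =>
    hQ.isVectorField.degree 1 _ (lowered_mem_homog α)
  choose ρ h hρh using fun α => (exists_of_mem_homog (hq α)).2.2 rfl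
  -- Chosen so that `-(1/2) c_{αβγ} e^β e^γ` equals the quadratic part of `Q_𝓔 e_α`, as `∂_α H`
  -- requires.
  let c : P ⊕ N → P ⊕ N → P ⊕ N → SmoothFun U := fun α β γ => h α γ β - h α β γ
  have hdd : ∀ α β γ, dOdd γ (dOdd β (QE (lowered G α))) = -base (c α β γ) := fun α β γ => by
    rw [hρh α, dOdd_dOdd_sum, ← base_neg, neg_sub]
  have hr : ∀ α β γ, c α γ β = - c α β γ := fun α β γ => (neg_sub _ _).symm
  -- `Q_𝓔` kills the constant `{e_α, e_β}`, so `∂_α Q_𝓔 e_β = -∂_β Q_𝓔 e_α`; a further derivative by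
  -- `e^γ` gives the antisymmetry.
  have hl : ∀ α β γ, c β α γ = - c α β γ := fun α β γ => by
    have h1 := hQ.map_lowered_poisson hG (lowered G β) α
    have h2 : dOdd α (lowered G β : FunE U P N) = G β α • 1 := by
      simp [lowered, dOdd_odd, -Fintype.sum_sum_type]
    rw [h2, map_smul, hQ.isVectorField.map_one, smul_zero, poisson_lowered hG hs,
      parity_homog (dOdd_mem_homog β (hq α)).1, eq_comm, sub_eq_zero] at h1
    have h3 := congrArg (dOdd γ) h1
    simp only [Nat.add_one_sub_one, pow_one, neg_one_smul, map_neg, hdd, neg_neg] at h3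
    refine base_injective (S := P ⊕ N) ?_
    rw [base_neg, h3, neg_neg]
  have hlow : ∀ α, QE (lowered G α) = dOdd α (hamiltonian ρ c) := fun α => by
    rw [hρh α, dOdd_hamiltonian hl hr, sub_eq_add_neg]
    congr 1
    have e1 : ∀ β γ, (base (c α β γ) * odd β * odd γ : FunE U P N)
        = -(base (h α γ β) * odd γ * odd β) - base (h α β γ) * odd β * odd γ := fun β γ => by
      rw [base_sub, sub_mul, sub_mul, mul_assoc (base (h α γ β)), odd_mul_odd]
      noncomm_ring
    simp only [e1, Finset.sum_sub_distrib, Finset.sum_neg_distrib]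
    rw [Finset.sum_comm]
    module
  have hH := hamiltonian_mem_homog ρ c
  -- Write `Q_𝓔 f = k_α e^α`, of degree 1. Since `{e_α, f} = 0`, the commutation rule gives `k_α =
  -- {Q_𝓔 e_α, f}`, and only the momentum part of `Q_𝓔 e_α` contributes.
  have hbase : ∀ f, QE (base f) = poisson G (hamiltonian ρ c) (base f) := fun f => by
    obtain ⟨k, hk⟩ := (exists_of_mem_homog (hQ.isVectorField.degree 0 _ (base_mem_homog f))).2.1 rfl
    have h1 : ∀ α, (base (k α) : FunE U P N) = ∑ i, base (ρ α i * partialX U i f) := fun α => by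
      have h2 := hQ.map_lowered_poisson hG (base f) α
      rw [dOdd_base, _root_.map_zero, eq_comm, sub_eq_zero, hlow, poisson_base, hk] at h2
      simp only [dP_dOdd_hamiltonian hl hr, ← base_mul] at h2
      rw [h2]
      simp [dOdd_mul, dOdd_base, dOdd_odd, parity_base, -Fintype.sum_sum_type]
    rw [hk, poisson_base]
    simp only [h1, dP_hamiltonian, Finset.sum_mul]
    rw [Finset.sum_comm]
    refine Finset.sum_congr rfl fun i _ => Finset.sum_congr rfl fun α _ => ?_
    rw [base_mul, mul_assoc, mul_assoc, base_mul_comm (partialX U i f)]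
  have hodd : ∀ α, QE (odd α) = poisson G (hamiltonian ρ c) (odd α) := fun α => by
    rw [odd_eq_sum_lowered hG, ← poissonLeft_apply, map_sum, map_sum]
    refine Finset.sum_congr rfl fun β _ => ?_
    rw [map_smul, map_smul, hlow, poissonLeft_apply, poisson_lowered hG hs,
      parity_homog (dOdd_mem_homog β hH).1]
    norm_num
  -- The discrepancy `Q_𝓔 p_i + ∂_i H` has degree 3, and the commutation rule for `{e_α, p_i} = 0`
  -- annihilates all its odd derivatives.
  have hmom : ∀ i, QE (mom i) = poisson G (hamiltonian ρ c) (mom i) := fun i => by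
    rw [poisson_mom, ← sub_eq_zero, sub_neg_eq_add]
    refine eq_zero_of_dOdd_eq_zero
      (add_mem (hQ.isVectorField.degree 2 _ (mom_mem_homog i)) (dX_mem_homog i hH)) fun α => ?_
    have h2 := hQ.map_lowered_poisson hG (mom i) α
    rw [dOdd_mom, _root_.map_zero, poisson_mom, hlow, dX_dOdd] at h2
    rw [map_add, ← neg_eq_zero, h2]
    abel
  refine ⟨ρ, c, hl, hr, fun F => ?_⟩
  rw [← poissonLeft_apply, hQ.isVectorField.ext (isVectorField_poissonLeft hH)
    (fun f => by rw [hbase, poissonLeft_apply]) (fun i => by rw [hmom, poissonLeft_apply])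
    (fun α => by rw [hodd, poissonLeft_apply])]

theorem IsStructureFunctions.map_lowered {QE : Module.End ℝ (FunE U P N)}
    {ρ : P ⊕ N → I → SmoothFun U} {c : P ⊕ N → P ⊕ N → P ⊕ N → SmoothFun U}
    (h : IsStructureFunctions G QE ρ c) (hG : IsUnit G.det) (hs : G.IsSymm) (α : P ⊕ N) :
    QE (lowered G α) = ∑ i, base (ρ α i) * mom i
      - (1 / 2 : ℝ) • ∑ β, ∑ γ, base (c α β γ) * odd β * odd γ := by
  rw [h.hamiltonian_eq, poisson_lowered hG hs,
    parity_homog (dOdd_mem_homog α (hamiltonian_mem_homog ρ c)).1,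
    dOdd_hamiltonian h.antisymm_left h.antisymm_right]
  norm_num

/-- `∂_α H` equals `Q_𝓔 e_α`, so it does not depend on the choice; `∂_{p_i}` of it is `ρ^i_α`, and
two more odd derivatives give `-c_{αβγ}`. -/
theorem IsStructureFunctions.unique {QE : Module.End ℝ (FunE U P N)}
    {ρ ρ' : P ⊕ N → I → SmoothFun U} {c c' : P ⊕ N → P ⊕ N → P ⊕ N → SmoothFun U}
    (h : IsStructureFunctions G QE ρ c) (h' : IsStructureFunctions G QE ρ' c')
    (hG : IsUnit G.det) (hs : G.IsSymm) : ρ = ρ' ∧ c = c' := by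
  have key : ∀ α, dOdd α (hamiltonian ρ c) = dOdd α (hamiltonian ρ' c') := fun α => by
    rw [dOdd_hamiltonian h.antisymm_left h.antisymm_right,
      dOdd_hamiltonian h'.antisymm_left h'.antisymm_right, ← h.map_lowered hG hs,
      ← h'.map_lowered hG hs]
  constructor
  · ext1 α; ext1 i
    refine base_injective (S := P ⊕ N) ?_
    rw [← dP_dOdd_hamiltonian h.antisymm_left h.antisymm_right, key,
      dP_dOdd_hamiltonian h'.antisymm_left h'.antisymm_right]
  · have hdd : ∀ {ρ : P ⊕ N → I → SmoothFun U} {c : P ⊕ N → P ⊕ N → P ⊕ N → SmoothFun U},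
        IsStructureFunctions G QE ρ c → ∀ α β γ,
        dOdd γ (dOdd β (dOdd α (hamiltonian ρ c))) = -base (c α β γ) := by
      intro ρ c h α β γ
      have : dOdd α (hamiltonian ρ c) = ∑ i, base (ρ α i) * mom i
          + ∑ β, ∑ γ, base ((-(1 / 2 : ℝ)) • c α β γ) * odd β * odd γ := by
        rw [dOdd_hamiltonian h.antisymm_left h.antisymm_right]
        simp only [base_smul, smul_mul_assoc, ← Finset.smul_sum]
        module
      rw [this, dOdd_dOdd_sum, h.antisymm_right α β γ, ← base_neg]
      congr 1
      module
    ext1 α; ext1 β; ext1 γ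
    refine base_injective (S := P ⊕ N) (neg_injective ?_)
    rw [← hdd h, ← hdd h', key]

theorem IsHomological.existsUnique_structureFunctions {QE : Module.End ℝ (FunE U P N)}
    (hQ : IsHomological G QE) (hG : IsUnit G.det) (hs : G.IsSymm) :
    ∃! s : (P ⊕ N → I → SmoothFun U) × (P ⊕ N → P ⊕ N → P ⊕ N → SmoothFun U),
      IsStructureFunctions G QE s.1 s.2 := by
  obtain ⟨ρ, c, h⟩ := hQ.exists_structureFunctions hG hs
  refine ⟨(ρ, c), h, fun s hs' => ?_⟩
  obtain ⟨h1, h2⟩ := hs'.unique h hG hs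
  exact Prod.ext h1 h2

end Hamiltonian

/-! ### Linear substitutions of the odd coordinates, on generators. -/

section Substitution

variable {I : Type*} [Fintype I] {U : Opens (I → ℝ)} {S T : Type*}

theorem subst_pureFun (L : (S → ℝ) →ₗ[ℝ] (T → ℝ)) (f : SmoothFun U) (q : MvPolynomial I ℝ)
    (w : ExteriorAlgebra ℝ (S → ℝ)) :
    subst L (pureFun f q w) = pureFun f q (ExteriorAlgebra.map L w) := rfl

theorem subst_base (L : (S → ℝ) →ₗ[ℝ] (T → ℝ)) (f : SmoothFun U) :
    subst L (base f : GFun U S) = base f := by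
  rw [base_eq, subst_pureFun, map_one, base_eq]

theorem subst_mom (L : (S → ℝ) →ₗ[ℝ] (T → ℝ)) (i : I) :
    subst L (mom i : GFun U S) = mom i := by
  rw [mom_eq, subst_pureFun, map_one, mom_eq]

theorem subst_odd [DecidableEq S] (L : (S → ℝ) →ₗ[ℝ] (T → ℝ)) (s : S) :
    subst L (odd s : GFun U S) = pureFun 1 1 (ExteriorAlgebra.ι ℝ (L (Pi.single s 1))) := by
  rw [odd_eq, subst_pureFun, ExteriorAlgebra.map_apply_ι]

end Substitution

/-! ### The bundle `𝓥`: pullback, involution, connections and their coefficients. -/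

section Bundle

variable {I P N : Type*} [Fintype I] [Fintype P] [Fintype N]
  [DecidableEq I] [DecidableEq P] [DecidableEq N] {U : Opens (I → ℝ)}

theorem pullback_base (f : SmoothFun U) : pullback (base f : FunE U P N) = base f := subst_base _ f

theorem pullback_mom (i : I) : pullback (mom i : FunE U P N) = mom i := subst_mom _ i

theorem pullback_odd (α : P ⊕ N) : pullback (odd α : FunE U P N) = eV α := by
  rw [pullback, subst_odd, eV, odd_eq]
  congr 2
  ext (β | a) <;> simp [Pi.single_apply]

theorem involutionV_base (f : SmoothFun U) : involutionV (base f : FunV U P N) = base f :=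
  subst_base _ f

theorem involutionV_mom (i : I) : involutionV (mom i : FunV U P N) = mom i := subst_mom _ i

theorem involutionV_eV_inl (a : P) :
    involutionV (eV (Sum.inl a) : FunV U P N) = eV (Sum.inl a) := by
  rw [involutionV, eV, subst_odd, odd_eq]
  congr 2
  ext ((b | d) | b) <;> simp [Pi.single_apply]

theorem involutionV_eV_inr (d : N) :
    involutionV (eV (Sum.inr d) : FunV U P N) = -eV (Sum.inr d) := by
  rw [involutionV, eV, subst_odd, odd_eq, ← neg_one_smul ℝ (pureFun _ _ _), ← pureFun_smul_left,
    ← pureFun_smul_right, ← map_smul]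
  congr 2
  ext ((b | d) | b) <;> simp [Pi.single_apply, apply_ite (Neg.neg : ℝ → ℝ)]

theorem involutionV_xi (a : P) : involutionV (xi a : FunV U P N) = xi a := by
  rw [involutionV, xi, subst_odd, odd_eq]
  congr 2
  ext ((b | d) | b) <;> simp [Pi.single_apply]

/-- Restriction of functions on `𝓥` to the zero section. -/
noncomputable def restrictZero : FunV U P N →ₐ[ℝ] FunE U P N :=
  subst (LinearMap.pi fun α => LinearMap.proj (Sum.inl α))

theorem restrictZero_eV (α : P ⊕ N) : restrictZero (eV α : FunV U P N) = odd α := by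
  rw [restrictZero, eV, subst_odd, odd_eq]
  congr 2
  ext β; simp [Pi.single_apply]

theorem restrictZero_xi (a : P) : restrictZero (xi a : FunV U P N) = 0 := by
  rw [restrictZero, xi, subst_odd, ← pureFun_zero_right 1 1, ← map_zero (ExteriorAlgebra.ι ℝ)]
  congr 2

theorem restrictZero_pullback (F : FunE U P N) : restrictZero (pullback F) = F := by
  induction F using GFun.mul_induction with
  | hbase f => rw [pullback_base]; exact subst_base _ f
  | hmom i => rw [pullback_mom]; exact subst_mom _ i
  | hodd α => rw [pullback_odd, restrictZero_eV]
  | hmul F G hF hG => rw [map_mul, map_mul, hF, hG]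
  | hadd F G hF hG => rw [map_add, map_add, hF, hG]

theorem parity_pullback (F : FunE U P N) : parity (pullback F) = pullback (parity F) := by
  induction F using GFun.mul_induction with
  | hbase f => rw [pullback_base, parity_base, parity_base, pullback_base]
  | hmom i => rw [pullback_mom, parity_mom, parity_mom, pullback_mom]
  | hodd α => rw [pullback_odd, parity_odd, map_neg, pullback_odd, eV, parity_odd]
  | hmul F G hF hG => simp only [map_mul, hF, hG]
  | hadd F G hF hG => simp only [map_add, hF, hG]

theorem dOdd_inr_pullback (a : P) (F : FunE U P N) : dOdd (Sum.inr a) (pullback F) = 0 := by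
  induction F using GFun.mul_induction with
  | hbase f => rw [pullback_base, dOdd_base]
  | hmom i => rw [pullback_mom, dOdd_mom]
  | hodd α => rw [pullback_odd, eV, dOdd_odd, if_neg (by simp)]
  | hmul F G hF hG => rw [map_mul, dOdd_mul, hF, hG, mul_zero, zero_mul, add_zero]
  | hadd F G hF hG => rw [map_add, map_add, hF, hG, add_zero]

theorem pullback_mem_homog {k : ℕ} {F : FunE U P N} (hF : F ∈ homog U (P ⊕ N) k) :
    pullback F ∈ homog U ((P ⊕ N) ⊕ P) k := by
  refine homog_induction (C := fun k F => pullback F ∈ homog U ((P ⊕ N) ⊕ P) k)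
    ?_ ?_ ?_ ?_ ?_ ?_ hF
  · intro f; rw [pullback_base]; exact base_mem_homog f
  · intro i k F h; rw [map_mul, pullback_mom, add_comm]; exact homog_mul (mom_mem_homog i) h
  · intro s k F h; rw [map_mul, pullback_odd, add_comm]; exact homog_mul (odd_mem_homog _) h
  · intro k; rw [map_zero]; exact zero_mem _
  · intro k F G h1 h2; rw [map_add]; exact add_mem h1 h2
  · intro k r F h; rw [map_smul]; exact Submodule.smul_mem _ _ h

/-! ### Connections and their coefficients -/

theorem dOdd_coefficients (φ : P → P ⊕ N → SmoothFun U) (b : P) (α : P ⊕ N) :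
    dOdd (Sum.inl α) (dOdd (Sum.inr b) (∑ b, ∑ α, base (φ b α) * eV α * xi b : FunV U P N))
      = -base (φ b α) := by
  simp only [eV, xi, map_sum, dOdd_mul, dOdd_base, dOdd_odd, parity_base, parity_odd, map_mul,
    reduceCtorEq, if_false, zero_mul, mul_zero, add_zero, zero_add, Sum.inl.injEq, Sum.inr.injEq,
    mul_ite, mul_one, mul_neg, apply_ite (dOdd (Sum.inl α) : FunV U P N → FunV U P N), map_neg,
    map_zero]
  simp [-Fintype.sum_sum_type]

theorem HasCoefficients.unique {Q : Module.End ℝ (FunV U P N)}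
    {ψ ψ' : P → P → P ⊕ N → SmoothFun U} (h : HasCoefficients Q ψ) (h' : HasCoefficients Q ψ') :
    ψ = ψ' := by
  ext1 a; ext1 b; ext1 α
  refine base_injective (S := (P ⊕ N) ⊕ P) (neg_injective ?_)
  rw [← dOdd_coefficients, ← dOdd_coefficients, ← h a, ← h' a]

theorem sum_pullback_mul_xi_single (a : P) :
    ∑ b, pullback ((Pi.single a 1 : P → FunE U P N) b) * xi b = xi a := by
  rw [Finset.sum_eq_single a]
  · rw [Pi.single_eq_same, map_one, one_mul]
  · intro b _ h; rw [Pi.single_eq_of_ne h, map_zero, zero_mul]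
  · simp

theorem xi_mem_dualSections (a : P) : (xi a : FunV U P N) ∈ dualSections U P N :=
  ⟨Pi.single a 1, (sum_pullback_mul_xi_single a).symm⟩

/-- Preserving sections makes `Q ξ^a` linear in `ξ`, and the degree 2 of `Q ξ^a` then forces its
coefficients to have degree 1. -/
theorem IsConnection.exists_coefficients {QE : Module.End ℝ (FunE U P N)}
    {Q : Module.End ℝ (FunV U P N)} (hQ : IsConnection QE Q) : ∃ ψ, HasCoefficients Q ψ := by
  have key : ∀ a, ∃ φ : P → P ⊕ N → SmoothFun U, Q (xi a) = ∑ b, ∑ α, base (φ b α) * eV α * xi b := by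
    intro a
    obtain ⟨F, hF⟩ := hQ.preserves _ (xi_mem_dualSections a)
    have hdeg : Q (xi a) ∈ homog U ((P ⊕ N) ⊕ P) 2 := hQ.isVectorField.degree 1 _ (odd_mem_homog _)
    have h1 : ∀ b, ∃ f : P ⊕ N → SmoothFun U, pullback (F b) = ∑ α, base (f α) * eV α := by
      intro b
      -- `F b` is not assumed homogeneous; its degree is obtained by differentiating `Q ξ^a` along
      -- `ξ^b`.
      have h2 : dOdd (Sum.inr b) (Q (xi a)) = parity (pullback (F b)) := by
        rw [hF]
        simp only [map_sum, dOdd_mul, dOdd_inr_pullback, zero_mul, zero_add, xi, dOdd_odd,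
          Sum.inr.injEq, mul_ite, mul_one, mul_zero]
        simp
      have h3 := parity_mem_homog (dOdd_mem_homog (Sum.inr b) hdeg).1
      rw [h2, parity_parity] at h3
      obtain ⟨f, hf⟩ := (exists_of_mem_homog h3).2.1 rfl
      refine ⟨fun α => f (Sum.inl α), ?_⟩
      -- The normal form on `𝓥` could involve `ξ`; restricting to the zero section discards those
      -- terms without changing `F b`.
      rw [← restrictZero_pullback (F b), hf, Fintype.sum_sum_type]
      simp only [map_add, map_sum, map_mul]
      rw [Finset.sum_eq_zero (s := (Finset.univ : Finset P)) fun a _ => by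
        rw [show (odd (Sum.inr a) : FunV U P N) = xi a from rfl, restrictZero_xi, map_zero, mul_zero],
        add_zero]
      refine Finset.sum_congr rfl fun α _ => ?_
      rw [show (odd (Sum.inl α) : FunV U P N) = eV α from rfl, restrictZero_eV, pullback_odd]
      congr 1
      exact (congrArg pullback (subst_base _ _)).trans (pullback_base _)
    choose f hf using h1
    refine ⟨f, ?_⟩
    rw [hF]
    simp only [hf, Finset.sum_mul]
  choose ψ hψ using key
  exact ⟨ψ, hψ⟩

theorem IsConnection.ext {QE : Module.End ℝ (FunE U P N)} {Q Q' : Module.End ℝ (FunV U P N)}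
    {ψ : P → P → P ⊕ N → SmoothFun U} (hQ : IsConnection QE Q) (hQ' : IsConnection QE Q')
    (h : HasCoefficients Q ψ) (h' : HasCoefficients Q' ψ) : Q = Q' := by
  refine hQ.isVectorField.ext hQ'.isVectorField (fun f => ?_) (fun i => ?_) (fun s => ?_)
  · rw [← pullback_base, hQ.projects, hQ'.projects]
  · rw [← pullback_mom, hQ.projects, hQ'.projects]
  · rcases s with α | a
    · rw [← eV, ← pullback_odd, hQ.projects, hQ'.projects]
    · exact (h a).trans (h' a).symm

theorem IsStructureFunctions.exists_connection {G : Matrix (P ⊕ N) (P ⊕ N) ℝ}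
    {QE : Module.End ℝ (FunE U P N)} {ρ : P ⊕ N → I → SmoothFun U}
    {c : P ⊕ N → P ⊕ N → P ⊕ N → SmoothFun U} (hs : IsStructureFunctions G QE ρ c)
    (hQE : IsVectorField 1 QE) (ψ : P → P → P ⊕ N → SmoothFun U) :
    ∃ Q : Module.End ℝ (FunV U P N), IsConnection QE Q ∧ HasCoefficients Q ψ := by
  have hH := hamiltonian_mem_homog ρ c
  have hcoef : ∀ a, (∑ b, ∑ α, base (ψ a b α) * eV α * xi b : FunV U P N)
      ∈ homog U ((P ⊕ N) ⊕ P) 2 := fun a => by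
    refine sum_mem fun b _ => sum_mem fun α _ => ?_
    have := homog_mul (homog_mul (base_mem_homog (ψ a b α)) (odd_mem_homog (Sum.inl α)))
      (odd_mem_homog (Sum.inr b))
    simp only [Nat.reduceAdd] at this
    exact this
  let C : (P ⊕ N) ⊕ P → FunV U P N := Sum.elim (fun α => pullback (QE (odd α)))
    (fun a => ∑ b, ∑ α, base (ψ a b α) * eV α * xi b)
  -- The components along `𝓔` are those of `Q_𝓔`; since `Q_𝓔 = {H, ·}`, its component along `x^i` is
  -- `∂_{p_i} H`.
  let Q : Module.End ℝ (FunV U P N) := coordField (fun i => pullback (dP i (hamiltonian ρ c)))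
    (fun i => pullback (QE (mom i))) C
  have hvf : IsVectorField 1 Q := isVectorField_coordField
    (fun i => pullback_mem_homog (dP_mem_homog i hH).1)
    (fun i => pullback_mem_homog (hQE.degree 2 _ (mom_mem_homog i))) (by
      rintro (α | a)
      · exact pullback_mem_homog (hQE.degree 1 _ (odd_mem_homog α))
      · exact hcoef a)
  have hxi : HasCoefficients Q ψ := fun a => coordField_odd _ _ C (Sum.inr a)
  have hproj : ∀ F : FunE U P N, Q (pullback F) = pullback (QE F) := by
    -- Both composites are odd derivations along the algebra map `pullback`, so agreement on
    -- generators suffices.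
    refine LinearMap.congr_fun (f := Q ∘ₗ pullback.toLinearMap) (g := pullback.toLinearMap ∘ₗ QE)
      (leibniz_ext (φ := pullback) (σ := fun F => pullback (parity F)) (fun F K => ?_)
        (fun F K => ?_) (fun f => ?_) (fun i => ?_) fun α => ?_)
    · simp only [LinearMap.comp_apply, AlgHom.toLinearMap_apply]
      rw [map_mul, hvf.leibniz, Function.iterate_one, parity_pullback]
    · simp only [LinearMap.comp_apply, AlgHom.toLinearMap_apply]
      rw [hQE.leibniz, map_add, map_mul, map_mul, Function.iterate_one]
    · simp only [LinearMap.comp_apply, AlgHom.toLinearMap_apply]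
      rw [pullback_base, coordField_base, hs.hamiltonian_eq, poisson_base, map_sum]
      simp only [map_mul, pullback_base]
    · simp only [LinearMap.comp_apply, AlgHom.toLinearMap_apply]
      rw [pullback_mom, coordField_mom]
    · simp only [LinearMap.comp_apply, AlgHom.toLinearMap_apply]
      rw [pullback_odd, eV, coordField_odd]
      rfl
  refine ⟨Q, ⟨hvf, hproj, ?_⟩, hxi⟩
  rintro _ ⟨F, rfl⟩
  refine ⟨fun b => QE (F b) + ∑ a, parity (F a) * ∑ α, base (ψ a b α) * odd α, ?_⟩
  simp only [map_sum, map_add, map_mul, hvf.leibniz, hproj, hxi _, Function.iterate_one,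
    parity_pullback, pullback_base, pullback_odd, add_mul, Finset.sum_add_distrib, Finset.sum_mul,
    Finset.mul_sum, mul_assoc]
  congr 1
  rw [Finset.sum_comm]

theorem IsConnection.isEndTwo_curvature {QE : Module.End ℝ (FunE U P N)}
    {Q : Module.End ℝ (FunV U P N)} (hQ : IsConnection QE Q) (hsq : ∀ F, QE (QE F) = 0) :
    IsEndTwo (curvature Q) where
  isVectorField := hQ.isVectorField.sq
  vertical F := by
    rw [curvature, LinearMap.comp_apply, hQ.projects, hQ.projects, hsq, map_zero]
  preserves s hs := hQ.preserves _ (hQ.preserves s hs)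

end Bundle

theorem SmoothFun.mul_neg {I : Type*} [Fintype I] {U : Opens (I → ℝ)} (f h : SmoothFun U) :
    f * -h = -(f * h) :=
  _root_.mul_neg f h

theorem SmoothFun.neg_mul {I : Type*} [Fintype I] {U : Opens (I → ℝ)} (f h : SmoothFun U) :
    -f * h = -(f * h) :=
  _root_.neg_mul f h

/-! ### Torsion, curvature, the Ricci tensor and its Courant algebroid counterpart. -/

section Ricci

variable {I P N : Type*} [Fintype I] [Fintype P] [Fintype N]
  [DecidableEq I] [DecidableEq P] [DecidableEq N] {U : Opens (I → ℝ)}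

/-- The function `f^i_b p_i ξ^b` on `𝓥`. -/
noncomputable def momXi (N : Type*) [DecidableEq N] (f : P → I → SmoothFun U) : FunV U P N :=
  ∑ b, ∑ i, base (f b i) * mom i * xi b

/-- The function `h_{bαβ} e^α e^β ξ^b` on `𝓥`. -/
noncomputable def quadXi (h : P → P ⊕ N → P ⊕ N → SmoothFun U) : FunV U P N :=
  ∑ b, ∑ α, ∑ β, base (h b α β) * eV α * eV β * xi b

/-- The function `h_{bkḋ} e^k e^ḋ ξ^b` on `𝓥`. -/
noncomputable def mixedXi (h : P → P → N → SmoothFun U) : FunV U P N :=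
  ∑ b, ∑ k, ∑ d, base (h b k d) * eV (Sum.inl k) * eV (Sum.inr d) * xi b

theorem eV_mul_eV (α β : P ⊕ N) : (eV α * eV β : FunV U P N) = -(eV β * eV α) := odd_mul_odd _ _

/-- A term changes sign exactly when it contains one dotted `e`. The two orders of a mixed pair
merge because `e^ḋ e^k = -e^k e^ḋ`, which produces the difference of coefficients; the factor 2
comes from subtracting the negated copy. -/
theorem sub_involutionV (f : P → I → SmoothFun U) (h : P → P ⊕ N → P ⊕ N → SmoothFun U) :
    (momXi N f + quadXi h) - involutionV (momXi N f + quadXi h)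
      = (2 : ℝ) • mixedXi fun b k d => h b (Sum.inl k) (Sum.inr d) - h b (Sum.inr d) (Sum.inl k) := by
  have h1 : involutionV (momXi N f) = momXi N f := by
    simp only [momXi, map_sum, map_mul, involutionV_base, involutionV_mom, involutionV_xi]
  rw [map_add, h1, add_sub_add_left_eq_sub]
  simp only [quadXi, mixedXi, map_sum, map_mul, involutionV_base, involutionV_xi,
    ← Finset.sum_sub_distrib, Finset.smul_sum]
  refine Finset.sum_congr rfl fun b _ => ?_
  simp only [Fintype.sum_sum_type, involutionV_eV_inl, involutionV_eV_inr, mul_neg, neg_mul,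
    neg_neg, sub_self, Finset.sum_const_zero, zero_add, add_zero, Finset.sum_add_distrib]
  rw [Finset.sum_comm (s := (Finset.univ : Finset N)), ← Finset.sum_add_distrib]
  refine Finset.sum_congr rfl fun k _ => ?_
  rw [← Finset.sum_add_distrib]
  refine Finset.sum_congr rfl fun d _ => ?_
  rw [base_sub, sub_mul, sub_mul, sub_mul, mul_assoc (base (h b (Sum.inr d) (Sum.inl k))),
    mul_assoc (base (h b (Sum.inr d) (Sum.inl k))), eV_mul_eV (Sum.inr d)]
  simp only [mul_neg, neg_mul, mul_assoc]
  module

theorem dOdd_mixedXi (h : P → P → N → SmoothFun U) (a : P) :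
    dOdd (Sum.inl (Sum.inl a)) (mixedXi h)
      = ∑ b, ∑ d, base (h b a d) * eV (Sum.inr d) * xi b := by
  have e : ∀ b k d, dOdd (Sum.inl (Sum.inl a))
      (base (h b k d) * eV (Sum.inl k) * eV (Sum.inr d) * xi b : FunV U P N)
      = if a = k then base (h b k d) * eV (Sum.inr d) * xi b else 0 := fun b k d => by
    simp only [eV, xi, dOdd_mul, dOdd_base, dOdd_odd, parity_base, zero_mul, zero_add,
      reduceCtorEq, if_false, mul_zero, add_zero, Sum.inl.injEq, mul_ite, mul_one, ite_mul]
  simp only [mixedXi, map_sum, e]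
  refine Finset.sum_congr rfl fun b _ => ?_
  rw [Finset.sum_comm]
  simp

theorem mixedXi_eq_zero_iff (h : P → P → N → SmoothFun U) :
    (mixedXi h : FunV U P N) = 0 ↔ ∀ b k d, h b k d = 0 := by
  refine ⟨fun h0 b k d => ?_, fun h0 => ?_⟩
  · have h1 := dOdd_mixedXi h k
    have e : ∀ b', dOdd (Sum.inl (Sum.inr d)) (∑ d, base (h b' k d) * eV (Sum.inr d) * xi b')
        = (base (h b' k d) * xi b' : FunV U P N) := fun b' => by
      simp only [eV, xi, map_sum, dOdd_mul, dOdd_base, dOdd_odd, parity_base, zero_mul, zero_add,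
        reduceCtorEq, if_false, mul_zero, add_zero, Sum.inl.injEq, Sum.inr.injEq, mul_ite, mul_one,
        ite_mul]
      simp
    have h2 := congrArg (fun F => dOdd (Sum.inr b) (dOdd (Sum.inl (Sum.inr d)) F)) h1
    rw [h0] at h2
    simp only [map_zero] at h2
    rw [map_sum] at h2
    simp only [e] at h2
    simp only [xi, map_sum, dOdd_mul, dOdd_base, dOdd_odd, parity_base, zero_mul, zero_add,
      Sum.inr.injEq, mul_ite, mul_one, mul_zero, Finset.sum_ite_eq, Finset.mem_univ, if_true] at h2
    exact base_injective (S := (P ⊕ N) ⊕ P) (h2.symm.trans base_zero.symm)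
  · simp [mixedXi, h0, base_zero]

theorem involutionV_eq_self_iff (f : P → I → SmoothFun U) (h : P → P ⊕ N → P ⊕ N → SmoothFun U) :
    involutionV (momXi N f + quadXi h) = momXi N f + quadXi h ↔
      ∀ b k d, h b (Sum.inl k) (Sum.inr d) = h b (Sum.inr d) (Sum.inl k) := by
  rw [eq_comm, ← sub_eq_zero, sub_involutionV, smul_eq_zero_iff_right (by norm_num),
    mixedXi_eq_zero_iff]
  simp only [sub_eq_zero]

/-! ### Torsion -/

variable {g : Matrix P P ℝ} {g' : Matrix N N ℝ} {QE : Module.End ℝ (FunE U P N)}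
  {Q : Module.End ℝ (FunV U P N)} {ρ : P ⊕ N → I → SmoothFun U}
  {c : P ⊕ N → P ⊕ N → P ⊕ N → SmoothFun U} {ψ : P → P → P ⊕ N → SmoothFun U}

theorem tautological_eq :
    tautological U N g = ∑ a, pullback (lowered (fullMetric g g') (Sum.inl a)) * xi a := by
  simp only [tautological, lowered, map_sum, map_smul, pullback_odd, Fintype.sum_sum_type,
    fullMetric, Matrix.fromBlocks_apply₁₁, Matrix.fromBlocks_apply₁₂, Matrix.zero_apply, zero_smul,
    Finset.sum_const_zero, add_zero]

/-- The Leibniz rule `Q τ = (Q_𝓔 e_a) ξ^a - e_a Q ξ^a`, where `Q_𝓔 e_a = ∂_a H`. -/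
theorem IsConnection.torsion_eq {G : Matrix (P ⊕ N) (P ⊕ N) ℝ} (hs : IsStructureFunctions G QE ρ c)
    (hG : IsUnit G.det) (hGs : G.IsSymm) (hQ : IsConnection QE Q) (hψ : HasCoefficients Q ψ) :
    Q (∑ a, pullback (lowered G (Sum.inl a)) * xi a) = momXi N (fun a i => ρ (Sum.inl a) i)
      + quadXi fun a β γ =>
        (-(1 / 2) : ℝ) • c (Sum.inl a) β γ - ∑ k, G (Sum.inl k) β • ψ k a γ := by
  have h1 : ∀ a, pullback (parity (lowered G (Sum.inl a))) * Q (xi a)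
      = -∑ b, ∑ β, ∑ γ, base (G (Sum.inl a) β • ψ a b γ) * eV β * eV γ * xi b := fun a => by
    rw [parity_homog (lowered_mem_homog _), hψ a, pow_one, neg_one_smul, map_neg, neg_mul, lowered,
      map_sum, Finset.mul_sum]
    congr 1
    refine Finset.sum_congr rfl fun b _ => ?_
    rw [Finset.sum_mul]
    refine Finset.sum_congr rfl fun β _ => ?_
    rw [Finset.mul_sum]
    refine Finset.sum_congr rfl fun γ _ => ?_
    rw [map_smul, pullback_odd, base_smul, smul_mul_assoc, smul_mul_assoc, smul_mul_assoc,
      smul_mul_assoc, ← mul_assoc, ← mul_assoc, base_mul_comm]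
  rw [map_sum]
  simp only [hQ.isVectorField.leibniz, hQ.projects, hs.map_lowered hG hGs, Function.iterate_one,
    parity_pullback, h1, map_sub, map_sum, map_smul, map_mul, pullback_base, pullback_mom,
    pullback_odd, quadXi, momXi, base_sub, base_smul, base_sum, sub_mul, Finset.sum_add_distrib,
    Finset.sum_sub_distrib, Finset.sum_mul, smul_mul_assoc, Finset.smul_sum,
    Finset.sum_neg_distrib]
  have h2 : ∑ a, ∑ b, ∑ β, ∑ γ, G (Sum.inl a) β • (base (ψ a b γ) * eV β * eV γ * xi b)
      = (∑ b, ∑ β, ∑ γ, ∑ a, G (Sum.inl a) β • (base (ψ a b γ) * eV β * eV γ * xi b) :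
        FunV U P N) := by
    rw [Finset.sum_comm]
    refine Finset.sum_congr rfl fun b _ => ?_
    rw [Finset.sum_comm]
    refine Finset.sum_congr rfl fun β _ => ?_
    rw [Finset.sum_comm]
  rw [h2]
  simp only [neg_smul, Finset.sum_neg_distrib]
  abel

/-- The `ψ` term with its indices in the order dotted, undotted drops out because the metric is
block diagonal. The two halves of `c` add up, and what remains is the condition with its first index
lowered; inverting `g` raises it. -/
theorem IsConnection.hasInvariantTorsion_iff (hg : g.IsSymm) (hg' : g'.IsSymm)
    (hgu : IsUnit g.det) (hgu' : IsUnit g'.det)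
    (hs : IsStructureFunctions (fullMetric g g') QE ρ c)
    (hQ : IsConnection QE Q) (hψ : HasCoefficients Q ψ) :
    HasInvariantTorsion g Q ↔ ∀ a b d, ψ a b (Sum.inr d) = cUp g c a b d := by
  rw [HasInvariantTorsion, tautological_eq (g' := g'), hQ.torsion_eq hs
    (fullMetric_isUnit_det hgu hgu') (fullMetric_isSymm hg hg') hψ, involutionV_eq_self_iff]
  have e : ∀ a b d, ((-(1 / 2) : ℝ) • c (Sum.inl a) (Sum.inl b) (Sum.inr d)
      - ∑ k, fullMetric g g' (Sum.inl k) (Sum.inl b) • ψ k a (Sum.inr d)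
      = (-(1 / 2) : ℝ) • c (Sum.inl a) (Sum.inr d) (Sum.inl b)
      - ∑ k, fullMetric g g' (Sum.inl k) (Sum.inr d) • ψ k a (Sum.inl b)) ↔
      ∑ k, g b k • ψ k a (Sum.inr d) = c (Sum.inl b) (Sum.inl a) (Sum.inr d) := by
    intro a b d
    simp only [fullMetric, Matrix.fromBlocks_apply₁₁, Matrix.fromBlocks_apply₁₂, Matrix.zero_apply,
      zero_smul, Finset.sum_const_zero, sub_zero]
    rw [hs.antisymm_right (Sum.inl a) (Sum.inl b), hs.antisymm_left (Sum.inl a) (Sum.inl b)]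
    simp only [fun k => show g k b = g b k from hg.apply b k]
    rw [sub_eq_iff_eq_add, ← sub_eq_iff_eq_add', eq_comm]
    refine Eq.congr rfl ?_
    module
  simp only [e]
  constructor
  · intro h a b d
    rw [cUp]
    simp only [← h]
    exact (sum_smul_sum_smul_of_mul_eq_one (Matrix.nonsing_inv_mul g hgu)
      (fun k => ψ k b (Sum.inr d)) a).symm
  · intro h a b d
    simp only [h, cUp]
    exact sum_smul_sum_smul_of_mul_eq_one (Matrix.mul_nonsing_inv g hgu)
      (fun k => c (Sum.inl k) (Sum.inl a) (Sum.inr d)) b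

/-! ### The Ricci tensor -/

/-- The derivative `ρ^i_α ∂f/∂x^i` along the anchored frame vector `e_α`. -/
noncomputable def frameDeriv (ρ : P ⊕ N → I → SmoothFun U) (α : P ⊕ N) (f : SmoothFun U) :
    SmoothFun U :=
  ∑ i, ρ α i * partialX U i f

theorem IsConnection.map_base {G : Matrix (P ⊕ N) (P ⊕ N) ℝ} (hs : IsStructureFunctions G QE ρ c)
    (hQ : IsConnection QE Q) (f : SmoothFun U) :
    Q (base f) = ∑ β, base (frameDeriv ρ β f) * eV β := by
  rw [← pullback_base, hQ.projects, hs.hamiltonian_eq, poisson_base]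
  simp only [dP_hamiltonian, frameDeriv, map_sum, map_mul, pullback_base, pullback_odd, base_sum,
    base_mul, Finset.sum_mul]
  rw [Finset.sum_comm]
  refine Finset.sum_congr rfl fun β _ => Finset.sum_congr rfl fun i _ => ?_
  rw [mul_assoc, ← base_mul_comm, ← mul_assoc]

theorem IsConnection.map_eV {G : Matrix (P ⊕ N) (P ⊕ N) ℝ} (hs : IsStructureFunctions G QE ρ c)
    (hG : IsUnit G.det) (hGs : G.IsSymm) (hQ : IsConnection QE Q) (α : P ⊕ N) :
    Q (eV α) = ∑ i, base (∑ δ, G⁻¹ α δ • ρ δ i) * mom i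
      + ∑ β, ∑ γ, base ((-(1 / 2) : ℝ) • ∑ δ, G⁻¹ α δ • c δ β γ) * eV β * eV γ := by
  rw [← pullback_odd, hQ.projects, odd_eq_sum_lowered hG, map_sum, map_sum]
  simp only [map_smul, hs.map_lowered hG hGs, map_sub, map_sum, map_mul, pullback_base,
    pullback_mom, pullback_odd, base_smul, base_sum, smul_mul_assoc, Finset.sum_mul, smul_sub,
    Finset.sum_sub_distrib, Finset.smul_sum]
  rw [sub_eq_add_neg, ← Finset.sum_neg_distrib]
  congr 1
  · exact Finset.sum_comm
  · simp only [← Finset.sum_neg_distrib]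
    rw [Finset.sum_comm]
    refine Finset.sum_congr rfl fun β _ => ?_
    rw [Finset.sum_comm]
    refine Finset.sum_congr rfl fun γ _ => Finset.sum_congr rfl fun δ _ => ?_
    module

/-- Apply `Q` to each factor of `ψ^a_{bα} e^α ξ^b`; the minus sign in the last term is that of
moving `Q` past `e^α`. The momentum term is invariant under the involution, so it will not reach the
Ricci tensor. -/
theorem IsConnection.curvature_xi {G : Matrix (P ⊕ N) (P ⊕ N) ℝ}
    (hs : IsStructureFunctions G QE ρ c)
    (hG : IsUnit G.det) (hGs : G.IsSymm) (hQ : IsConnection QE Q) (hψ : HasCoefficients Q ψ)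
    (a : P) :
    curvature Q (xi a) = momXi N (fun b i => ∑ α, ψ a b α * ∑ δ, G⁻¹ α δ • ρ δ i)
      + quadXi fun b β γ => frameDeriv ρ β (ψ a b γ)
        + ∑ α, ψ a b α * ((-(1 / 2) : ℝ) • ∑ δ, G⁻¹ α δ • c δ β γ)
        - ∑ k, ψ a k β * ψ k b γ := by
  have h1 : ∀ b α, Q (base (ψ a b α) * eV α * xi b)
      = ∑ β, base (frameDeriv ρ β (ψ a b α)) * eV β * eV α * xi b
        + (∑ i, base (ψ a b α * ∑ δ, G⁻¹ α δ • ρ δ i) * mom i * xi b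
        + ∑ β, ∑ γ, base (ψ a b α * ((-(1 / 2) : ℝ) • ∑ δ, G⁻¹ α δ • c δ β γ)) * eV β * eV γ * xi b)
        - ∑ k, ∑ γ, base (ψ a b α * ψ b k γ) * eV α * eV γ * xi k := by
    intro b α
    have hp : parity (eV α : FunV U P N) = -eV α := parity_odd _
    rw [hQ.isVectorField.leibniz, hQ.isVectorField.leibniz, hψ b, hQ.map_base hs,
      hQ.map_eV hs hG hGs]
    simp only [Function.iterate_one, map_mul, parity_base, hp, mul_neg, neg_mul,
      add_mul, mul_add, Finset.sum_mul, Finset.mul_sum]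
    have e1 : ∀ k γ, base (ψ a b α) * eV α * (base (ψ b k γ) * eV γ * xi k)
        = (base (ψ a b α * ψ b k γ) * eV α * eV γ * xi k : FunV U P N) := fun k γ => by
      rw [base_mul, mul_assoc (base (ψ a b α)) (base (ψ b k γ)), base_mul_comm (ψ b k γ) (eV α)]
      simp only [mul_assoc]
    have e2 : ∀ (f f' : SmoothFun U) (F : FunV U P N), base f * (base f' * F) = base (f * f') * F :=
      fun f f' F => by rw [base_mul, mul_assoc]
    have e3 : ∀ (f f' : SmoothFun U) (F F' : FunV U P N),
        base f * (base f' * F * F') = base (f * f') * F * F' :=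
      fun f f' F F' => by rw [base_mul]; simp only [mul_assoc]
    simp only [e1, e2, e3]
    simp only [Finset.mul_sum, Finset.sum_neg_distrib, ← sub_eq_add_neg]
  rw [curvature, LinearMap.comp_apply, hψ a]
  simp only [map_sum, h1, Finset.sum_add_distrib, Finset.sum_sub_distrib, momXi, quadXi,
    base_sub, base_add, base_sum, sub_mul, add_mul, Finset.sum_mul]
  have e1 : ∀ F : P → P ⊕ N → P ⊕ N → FunV U P N, ∑ x, ∑ α, ∑ β, F x α β = ∑ x, ∑ β, ∑ α, F x α β :=
    fun F => Finset.sum_congr rfl fun x _ => Finset.sum_comm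
  have e2 : ∀ F : P → P ⊕ N → I → FunV U P N, ∑ x, ∑ α, ∑ i, F x α i = ∑ x, ∑ i, ∑ α, F x α i :=
    fun F => Finset.sum_congr rfl fun x _ => Finset.sum_comm
  have e3 : ∀ F : P → P ⊕ N → P ⊕ N → P ⊕ N → FunV U P N,
      ∑ x, ∑ α, ∑ β, ∑ γ, F x α β γ = ∑ x, ∑ β, ∑ γ, ∑ α, F x α β γ := fun F =>
    Finset.sum_congr rfl fun x _ => Finset.sum_comm.trans
      (Finset.sum_congr rfl fun β _ => Finset.sum_comm)
  have e4 : ∀ F : P → P ⊕ N → P → P ⊕ N → FunV U P N,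
      ∑ x, ∑ β, ∑ k, ∑ γ, F x β k γ = ∑ k, ∑ β, ∑ γ, ∑ x, F x β k γ := fun F => by
    rw [Finset.sum_comm, Finset.sum_congr rfl fun β _ => Finset.sum_comm, Finset.sum_comm]
    exact Finset.sum_congr rfl fun k _ => Finset.sum_congr rfl fun β _ => Finset.sum_comm
  rw [e1, e2, e3, e4]
  abel

/-- Valid for every torsion. The factor `1/2` in the anti-self-dual part cancels the 2 of
`sub_involutionV`, and antisymmetry of `c` absorbs the `1/2` in `Q e^α`. -/
theorem IsConnection.ricci_eq {G : Matrix (P ⊕ N) (P ⊕ N) ℝ}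
    (hs : IsStructureFunctions G QE ρ c)
    (hG : IsUnit G.det) (hGs : G.IsSymm) (hQ : IsConnection QE Q) (hψ : HasCoefficients Q ψ) :
    ricci Q = tensorOf fun b d => ∑ a,
      (frameDeriv ρ (Sum.inr d) (ψ a b (Sum.inl a)) - frameDeriv ρ (Sum.inl a) (ψ a b (Sum.inr d))
        + ∑ α, ψ a b α * ∑ δ, G⁻¹ α δ • c δ (Sum.inl a) (Sum.inr d)
        - ∑ k, (ψ a k (Sum.inr d) * ψ k b (Sum.inl a)
          - ψ a k (Sum.inl a) * ψ k b (Sum.inr d))) := by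
  have h1 : ∀ a, dOdd (Sum.inl (Sum.inl a)) (antiSelfDual (curvature Q) (xi a))
      = ∑ b, ∑ d, base (frameDeriv ρ (Sum.inr d) (ψ a b (Sum.inl a))
        - frameDeriv ρ (Sum.inl a) (ψ a b (Sum.inr d))
        + ∑ α, ψ a b α * ∑ δ, G⁻¹ α δ • c δ (Sum.inl a) (Sum.inr d)
        - ∑ k, (ψ a k (Sum.inr d) * ψ k b (Sum.inl a)
          - ψ a k (Sum.inl a) * ψ k b (Sum.inr d))) * xi b * eV (Sum.inr d) := fun a => by
    rw [antiSelfDual, LinearMap.smul_apply, LinearMap.sub_apply, LinearMap.comp_apply,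
      LinearMap.comp_apply, AlgHom.toLinearMap_apply, AlgHom.toLinearMap_apply, involutionV_xi,
      hQ.curvature_xi hs hG hGs hψ, sub_involutionV, smul_smul, map_smul, dOdd_mixedXi]
    norm_num only [one_smul]
    refine Finset.sum_congr rfl fun b _ => Finset.sum_congr rfl fun d _ => ?_
    -- The contraction produces `e^ḋ ξ^b`, whereas the Ricci tensor is written with `ξ^b e^ḋ`; the
    -- swap flips all signs.
    rw [mul_assoc, mul_assoc, show (eV (Sum.inr d) : FunV U P N) * xi b = -(xi b * eV (Sum.inr d))
      from odd_mul_odd _ _, mul_neg, ← neg_mul, ← base_neg]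
    congr 2
    have h2 : ∀ α, ∑ δ, G⁻¹ α δ • c δ (Sum.inr d) (Sum.inl a)
        = -∑ δ, G⁻¹ α δ • c δ (Sum.inl a) (Sum.inr d) := fun α => by
      simp only [hs.antisymm_right _ (Sum.inl a), smul_neg, Finset.sum_neg_distrib]
    simp only [h2, smul_neg, SmoothFun.mul_neg, Finset.sum_neg_distrib, mul_smul_comm, ← Finset.smul_sum,
      Finset.sum_sub_distrib]
    module
  rw [ricci, contraction]
  simp only [h1, tensorOf, base_sum, Finset.sum_mul]
  rw [Finset.sum_comm]
  exact Finset.sum_congr rfl fun b _ => Finset.sum_comm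

theorem frameDeriv_sum {κ : Type*} (s : Finset κ) (α : P ⊕ N) (f : κ → SmoothFun U) :
    frameDeriv ρ α (∑ k ∈ s, f k) = ∑ k ∈ s, frameDeriv ρ α (f k) := by
  simp only [frameDeriv, map_sum, Finset.mul_sum]
  exact Finset.sum_comm

theorem sum_fullMetric_inv (hgu : IsUnit g.det) (hgu' : IsUnit g'.det) (f h : P ⊕ N → SmoothFun U) :
    ∑ α, f α * ∑ δ, (fullMetric g g')⁻¹ α δ • h δ
      = ∑ k, f (Sum.inl k) * ∑ l, g⁻¹ k l • h (Sum.inl l)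
        + ∑ k, f (Sum.inr k) * ∑ l, g'⁻¹ k l • h (Sum.inr l) := by
  simp only [fullMetric_inv hgu hgu', Fintype.sum_sum_type, Matrix.fromBlocks_apply₁₁,
    Matrix.fromBlocks_apply₁₂, Matrix.fromBlocks_apply₂₁, Matrix.fromBlocks_apply₂₂,
    Matrix.zero_apply, zero_smul, Finset.sum_const_zero, add_zero, zero_add]

/-- The Ricci tensor of a connection with invariant torsion. -/
theorem IsConnection.ricci_eq_ricciComponent (hg : g.IsSymm) (hg' : g'.IsSymm)
    (hgu : IsUnit g.det) (hgu' : IsUnit g'.det)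
    (hs : IsStructureFunctions (fullMetric g g') QE ρ c)
    (hQ : IsConnection QE Q) (hψ : HasCoefficients Q ψ) (ht : HasInvariantTorsion g Q) :
    ricci Q = tensorOf (ricciComponent g g' ρ c (traceCoeff ψ)) := by
  have hinv := (hQ.hasInvariantTorsion_iff hg hg' hgu hgu' hs hψ).1 ht
  have hi' : ∀ k f, g'⁻¹ k f = g'⁻¹ f k := fun k f => by
    conv_lhs => rw [← hg', ← Matrix.transpose_nonsing_inv, Matrix.transpose_apply]
  rw [hQ.ricci_eq hs (fullMetric_isUnit_det hgu hgu') (fullMetric_isSymm hg hg') hψ]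
  congr 1
  ext1 b; ext1 d
  have h1 : ∀ k a, ∑ l, g⁻¹ k l • c (Sum.inl l) (Sum.inl a) (Sum.inr d) = cUp g c k a d :=
    fun k a => rfl
  simp only [sum_fullMetric_inv hgu hgu', h1, hinv, Finset.sum_add_distrib, Finset.sum_sub_distrib]
  -- The decisive cancellation: the undotted part of `ψ^a_{bα} c^α_{aḋ}` equals `ψ^a_{kḋ} ψ^k_{ba}`
  -- after renaming indices, and the two enter with opposite signs. No untraced `ψ^a_{bc}` survives.
  have h2 : ∑ a, ∑ k, ψ a b (Sum.inl k) * cUp g c k a d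
      = ∑ a, ∑ k, cUp g c a k d * ψ k b (Sum.inl a) := by
    rw [Finset.sum_comm]
    exact Finset.sum_congr rfl fun k _ => Finset.sum_congr rfl fun a _ => mul_comm _ _
  have h3 : ∑ a, ∑ k, ψ a k (Sum.inl a) * cUp g c k b d
      = ∑ k, cUp g c k b d * traceCoeff ψ k := by
    rw [Finset.sum_comm]
    refine Finset.sum_congr rfl fun k _ => ?_
    rw [traceCoeff, Finset.mul_sum]
    exact Finset.sum_congr rfl fun a _ => mul_comm _ _
  have h4 : ∑ a, ∑ k, cUp g c a b k * ∑ l, g'⁻¹ k l • c (Sum.inr l) (Sum.inl a) (Sum.inr d)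
      = ∑ k, ∑ a, c (Sum.inr k) (Sum.inl a) (Sum.inr d) * cUpUp g g' c a b k := by
    simp only [cUpUp, Finset.mul_sum]
    rw [Finset.sum_comm (s := (Finset.univ : Finset N))]
    refine Finset.sum_congr rfl fun a _ => ?_
    rw [Finset.sum_comm]
    refine Finset.sum_congr rfl fun l _ => Finset.sum_congr rfl fun k _ => ?_
    rw [hi', mul_smul_comm, mul_smul_comm, mul_comm]
  rw [h2, h3, h4, ← frameDeriv_sum]
  simp only [ricciComponent, frameDeriv]
  rw [show ∑ a, ψ a b (Sum.inl a) = traceCoeff ψ b from rfl]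
  abel

/-! ### The generalized Ricci tensor of the Courant algebroid -/

theorem anchor_single (α : P ⊕ N) (f : SmoothFun U) :
    anchor ρ (Pi.single α 1) f = frameDeriv ρ α f := by
  rw [anchor, Finset.sum_eq_single α]
  · simp [frameDeriv]
  · intro β _ h; simp [Pi.single_eq_of_ne h]
  · simp

theorem anchor_zero (u : P ⊕ N → SmoothFun U) : anchor ρ u 0 = 0 := by
  simp [anchor]

theorem anchor_single_apply (u : P ⊕ N → SmoothFun U) (α β : P ⊕ N) :
    anchor ρ u ((Pi.single α 1 : P ⊕ N → SmoothFun U) β) = 0 := by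
  rw [Pi.single_apply]
  split_ifs
  · simp [anchor, partialX_one]
  · exact anchor_zero u

/-- The first argument stays general because the inner bracket `[e_a, e_ḋ]₋` in the trace has
nonconstant components. -/
theorem courant_single_right (G : Matrix (P ⊕ N) (P ⊕ N) ℝ) (w : P ⊕ N → SmoothFun U)
    (β γ : P ⊕ N) :
    courant G ρ c w (Pi.single β 1) γ = -frameDeriv ρ β (w γ)
      + ∑ δ, G⁻¹ γ δ • (∑ α, G α β • frameDeriv ρ δ (w α) + ∑ α, c α β δ * w α) := by
  simp only [courant, anchor_single_apply, anchor_single, zero_sub]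
  congr 1
  refine Finset.sum_congr rfl fun δ _ => ?_
  congr 2
  · refine Finset.sum_congr rfl fun α _ => ?_
    rw [Finset.sum_eq_single β]
    · simp
    · intro b _ h; simp [Pi.single_eq_of_ne h]
    · simp
  · refine Finset.sum_congr rfl fun α _ => ?_
    rw [Finset.sum_eq_single β]
    · simp
    · intro b _ h; simp [Pi.single_eq_of_ne h]
    · simp

theorem frameDeriv_single_apply (ρ : P ⊕ N → I → SmoothFun U) (δ α β : P ⊕ N) :
    frameDeriv ρ δ ((Pi.single α 1 : P ⊕ N → SmoothFun U) β) = 0 := by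
  rw [← anchor_single, anchor_single_apply]

theorem courant_single_single (G : Matrix (P ⊕ N) (P ⊕ N) ℝ) (α β γ : P ⊕ N) :
    courant G ρ c (Pi.single α 1) (Pi.single β 1) γ = ∑ δ, G⁻¹ γ δ • c α β δ := by
  simp only [courant_single_right, frameDeriv_single_apply, smul_zero, Finset.sum_const_zero,
    neg_zero, zero_add]
  refine Finset.sum_congr rfl fun δ _ => ?_
  congr 1
  rw [Finset.sum_eq_single α]
  · simp
  · intro b _ h; simp [Pi.single_eq_of_ne h]
  · simp

theorem IsDivergence.apply_eq {dvg : (P ⊕ N → SmoothFun U) →ₗ[ℝ] SmoothFun U}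
    (h : IsDivergence ρ dvg) (u : P ⊕ N → SmoothFun U) :
    dvg u = ∑ α, (u α * dvg (Pi.single α 1) + frameDeriv ρ α (u α)) := by
  have h1 : u = ∑ α, fun β => u α * (Pi.single α 1 : P ⊕ N → SmoothFun U) β := by
    ext1 β
    rw [Finset.sum_apply, Finset.sum_eq_single β]
    · simp
    · intro b _ h; simp [Pi.single_eq_of_ne (Ne.symm h)]
    · simp
  conv_lhs => rw [h1, map_sum]
  simp only [h.leibniz, anchor_single]

/-- The divergence operator with prescribed values on the frame. -/
theorem exists_isDivergence (ρ : P ⊕ N → I → SmoothFun U) (μ : P ⊕ N → SmoothFun U) :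
    ∃ dvg : (P ⊕ N → SmoothFun U) →ₗ[ℝ] SmoothFun U, IsDivergence ρ dvg ∧
      ∀ α, dvg (Pi.single α 1) = μ α := by
  -- This is the only candidate: the Leibniz rule applied to `u = u^α e_α` forces it, as in
  -- `IsDivergence.apply_eq`.
  refine ⟨{ toFun := fun u => ∑ α, (u α * μ α + frameDeriv ρ α (u α))
            map_add' := fun u v => ?_
            map_smul' := fun r u => ?_ }, ⟨fun f u => ?_⟩, fun α => ?_⟩
  · rw [← Finset.sum_add_distrib]
    refine Finset.sum_congr rfl fun α _ => ?_
    simp only [frameDeriv, Pi.add_apply, map_add, mul_add, Finset.sum_add_distrib, add_mul]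
    abel
  · rw [RingHom.id_apply, Finset.smul_sum]
    refine Finset.sum_congr rfl fun α _ => ?_
    simp only [frameDeriv, Pi.smul_apply, map_smul, mul_smul_comm, smul_mul_assoc, smul_add,
      Finset.smul_sum]
  · change ∑ α, (f * u α * μ α + frameDeriv ρ α (f * u α))
      = f * ∑ α, (u α * μ α + frameDeriv ρ α (u α)) + anchor ρ u f
    rw [anchor, Finset.mul_sum, ← Finset.sum_add_distrib]
    refine Finset.sum_congr rfl fun α _ => ?_
    simp only [frameDeriv, partialX_mul, mul_add, Finset.mul_sum, Finset.sum_add_distrib]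
    have e1 : ∑ i, ρ α i * (partialX U i f * u α) = ∑ i, u α * ρ α i * partialX U i f :=
      Finset.sum_congr rfl fun i _ => by ring
    have e2 : ∑ i, ρ α i * (f * partialX U i (u α)) = ∑ i, f * (ρ α i * partialX U i (u α)) :=
      Finset.sum_congr rfl fun i _ => by ring
    rw [e1, e2]
    ring
  · change ∑ β, ((Pi.single α 1 : P ⊕ N → SmoothFun U) β * μ β
      + frameDeriv ρ β ((Pi.single α 1 : P ⊕ N → SmoothFun U) β)) = μ α
    simp only [frameDeriv_single_apply, add_zero]
    rw [Finset.sum_eq_single α]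
    · simp
    · intro b _ h; simp [Pi.single_eq_of_ne h]
    · simp

/-- With `[e_ḋ, e_b]₊ = -c^a_{bḋ} e_a`, its divergence gives the `λ` term and the derivative of `c`;
`-ρ(e_ḋ)(div e_b)` gives the derivative of `λ`, and the trace gives the term quadratic in `c`. -/
theorem gRic_frame (hg' : g'.IsSymm) (hgu : IsUnit g.det) (hgu' : IsUnit g'.det)
    (hl : ∀ α β γ, c β α γ = - c α β γ) (hr : ∀ α β γ, c α γ β = - c α β γ)
    {dvg : (P ⊕ N → SmoothFun U) →ₗ[ℝ] SmoothFun U} (hd : IsDivergence ρ dvg)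
    {lam : P → SmoothFun U} (hlam : ∀ a, dvg (Pi.single (Sum.inl a) 1) = -lam a) (b : P) (d : N) :
    gRic (fullMetric g g') ρ c dvg (Pi.single (Sum.inl b) 1) (Pi.single (Sum.inr d) 1)
      = ricciComponent g g' ρ c lam b d := by
  have h1 : ∀ a, courant (fullMetric g g') ρ c (Pi.single (Sum.inr d) 1) (Pi.single (Sum.inl b) 1)
      (Sum.inl a) = -cUp g c a b d := fun a => by
    rw [courant_single_single, Fintype.sum_sum_type]
    simp only [fullMetric_inv hgu hgu', Matrix.fromBlocks_apply₁₁,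
      Matrix.fromBlocks_apply₁₂, Matrix.zero_apply, zero_smul, Finset.sum_const_zero, add_zero,
      cUp, ← Finset.sum_neg_distrib]
    refine Finset.sum_congr rfl fun k _ => ?_
    rw [← smul_neg, hr (Sum.inr d), ← hl (Sum.inr d), hr]
  have hneg : ∀ α f, frameDeriv ρ α (-f) = -frameDeriv ρ α f := fun α f => by
    simp only [frameDeriv, map_neg, SmoothFun.mul_neg, Finset.sum_neg_distrib]
  have hz : ∀ α, frameDeriv ρ α 0 = 0 := fun α => by simp [frameDeriv]
  have h2 : dvg (projPlus (courant (fullMetric g g') ρ c (Pi.single (Sum.inr d) 1)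
      (Pi.single (Sum.inl b) 1)))
      = ∑ k, cUp g c k b d * lam k - ∑ a, frameDeriv ρ (Sum.inl a) (cUp g c a b d) := by
    rw [hd.apply_eq, Fintype.sum_sum_type]
    simp only [projPlus, Sum.elim_inl, Sum.elim_inr, h1, hlam, SmoothFun.mul_neg, SmoothFun.neg_mul, neg_neg, hneg, hz, zero_mul,
      add_zero, Finset.sum_const_zero, Finset.sum_add_distrib, Finset.sum_neg_distrib,
      sub_eq_add_neg]
  have h3 : ∀ a k, courant (fullMetric g g') ρ c (Pi.single (Sum.inl a) 1)
      (Pi.single (Sum.inr d) 1) (Sum.inr k)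
      = ∑ f, g'⁻¹ k f • c (Sum.inl a) (Sum.inr d) (Sum.inr f) := fun a k => by
    rw [courant_single_single, Fintype.sum_sum_type]
    simp only [fullMetric_inv hgu hgu', Matrix.fromBlocks_apply₂₁,
      Matrix.fromBlocks_apply₂₂, Matrix.zero_apply, zero_smul, Finset.sum_const_zero, zero_add]
  -- For `w` in `V₋` the term `ρ(e_b) w` has no `V₊` component and `⟨ρ(e_δ) w, e_b⟩` vanishes by
  -- orthogonality, so only the structure functions contribute.
  have h4 : ∀ a, courant (fullMetric g g') ρ c (projMinus (courant (fullMetric g g') ρ c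
      (Pi.single (Sum.inl a) 1) (Pi.single (Sum.inr d) 1))) (Pi.single (Sum.inl b) 1) (Sum.inl a)
      = ∑ l, g⁻¹ a l • ∑ k, c (Sum.inr k) (Sum.inl b) (Sum.inl l)
        * ∑ f, g'⁻¹ k f • c (Sum.inl a) (Sum.inr d) (Sum.inr f) := fun a => by
    rw [courant_single_right, Fintype.sum_sum_type]
    have hm : ∀ k, fullMetric g g' (Sum.inr k) (Sum.inl b) = 0 := fun k => rfl
    simp only [fullMetric_inv hgu hgu', Matrix.fromBlocks_apply₁₁, Matrix.fromBlocks_apply₁₂,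
      Matrix.zero_apply, zero_smul, Finset.sum_const_zero, zero_add, add_zero,
      Fintype.sum_sum_type, projMinus, Sum.elim_inl, Sum.elim_inr, hz, neg_zero, smul_zero,
      mul_zero, hm, h3]
  rw [gRic, h2]
  simp only [anchor_single, hlam, hneg, sub_neg_eq_add, projPlus, Sum.elim_inl, h4]
  have hi' : ∀ k f, g'⁻¹ k f = g'⁻¹ f k := fun k f => by
    conv_lhs => rw [← hg', ← Matrix.transpose_nonsing_inv, Matrix.transpose_apply]
  rw [ricciComponent]
  -- Reordering the indices of both factors of `c` leaves one overall minus sign, which matches the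
  -- minus before the trace in `GRic`.
  have h5 : ∑ k, ∑ a, c (Sum.inr k) (Sum.inl a) (Sum.inr d) * cUpUp g g' c a b k
      = -∑ a, ∑ l, g⁻¹ a l • ∑ k, c (Sum.inr k) (Sum.inl b) (Sum.inl l)
        * ∑ f, g'⁻¹ k f • c (Sum.inl a) (Sum.inr d) (Sum.inr f) := by
    have e : ∀ k a f l, g'⁻¹ k f • g⁻¹ a l • (c (Sum.inr k) (Sum.inl a) (Sum.inr d)
        * c (Sum.inl l) (Sum.inl b) (Sum.inr f))
        = -(g⁻¹ a l • g'⁻¹ f k • (c (Sum.inr f) (Sum.inl b) (Sum.inl l)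
          * c (Sum.inl a) (Sum.inr d) (Sum.inr k))) := fun k a f l => by
      rw [hl (Sum.inl a) (Sum.inr k), hr (Sum.inl a) (Sum.inr d), neg_neg,
        hl (Sum.inl b) (Sum.inl l), hr (Sum.inl b) (Sum.inr f), neg_neg,
        hl (Sum.inr f) (Sum.inl b), SmoothFun.mul_neg, hi', smul_neg, smul_neg, smul_comm, mul_comm]
    simp only [cUpUp, cUp, Finset.mul_sum, Finset.smul_sum, mul_smul_comm, e,
      Finset.sum_neg_distrib]
    congr 1
    rw [Finset.sum_comm]
    refine Finset.sum_congr rfl fun a _ => ?_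
    rw [Finset.sum_congr rfl fun k _ => Finset.sum_comm, Finset.sum_comm]
    exact Finset.sum_congr rfl fun l _ => Finset.sum_comm
  rw [h5]
  simp only [frameDeriv]
  abel

end Ricci

end GradedRicci

/-! ### Assembly of the theorem. -/

open GradedRicci in
theorem mainTheorem1 {I P N : Type*} [Fintype I] [Fintype P] [Fintype N]
    [DecidableEq I] [DecidableEq P] [DecidableEq N]
    (U : TopologicalSpace.Opens (I → ℝ))
    (g : Matrix P P ℝ) (g' : Matrix N N ℝ)
    (hg : g.IsSymm) (hg' : g'.IsSymm) (hgu : IsUnit g.det) (hgu' : IsUnit g'.det)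
    (QE : Module.End ℝ (FunE U P N)) (hQE : IsHomological (fullMetric g g') QE) :
    -- the structure functions of `Q_𝓔` exist and are unique
    (∃! s : (P ⊕ N → I → SmoothFun U) × (P ⊕ N → P ⊕ N → P ⊕ N → SmoothFun U),
      IsStructureFunctions (fullMetric g g') QE s.1 s.2) ∧
    -- connections correspond to arbitrary coefficients `ψ^a_{bα}`
    (∀ Q : Module.End ℝ (FunV U P N), IsConnection QE Q →
      ∃! ψ : P → P → P ⊕ N → SmoothFun U, HasCoefficients Q ψ) ∧
    (∀ ψ : P → P → P ⊕ N → SmoothFun U,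
      ∃! Q : Module.End ℝ (FunV U P N), IsConnection QE Q ∧ HasCoefficients Q ψ) ∧
    ∀ (ρ : P ⊕ N → I → SmoothFun U) (c : P ⊕ N → P ⊕ N → P ⊕ N → SmoothFun U),
      IsStructureFunctions (fullMetric g g') QE ρ c →
      ∀ (Q : Module.End ℝ (FunV U P N)) (ψ : P → P → P ⊕ N → SmoothFun U),
        IsConnection QE Q → HasCoefficients Q ψ →
        IsEndTwo (curvature Q) ∧
        (HasInvariantTorsion g Q ↔ ∀ a b d, ψ a b (Sum.inr d) = cUp g c a b d) ∧
        (HasInvariantTorsion g Q →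
          -- the formula
          ricci Q = tensorOf (ricciComponent g g' ρ c (traceCoeff ψ)) ∧
          -- dependence on the free coefficients only through the trace
          (∀ (Q' : Module.End ℝ (FunV U P N)) (ψ' : P → P → P ⊕ N → SmoothFun U),
            IsConnection QE Q' → HasCoefficients Q' ψ' → HasInvariantTorsion g Q' →
            traceCoeff ψ' = traceCoeff ψ → ricci Q' = ricci Q) ∧
          -- comparison with the generalized Ricci tensor of Courant algebroids
          (∃ dvg : (P ⊕ N → SmoothFun U) →ₗ[ℝ] SmoothFun U, IsDivergence ρ dvg ∧
            ∀ a, dvg (Pi.single (Sum.inl a) 1) = - traceCoeff ψ a) ∧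
          ∀ dvg : (P ⊕ N → SmoothFun U) →ₗ[ℝ] SmoothFun U, IsDivergence ρ dvg →
            (∀ a, dvg (Pi.single (Sum.inl a) 1) = - traceCoeff ψ a) →
            ricci Q = tensorOf fun b d => gRic (fullMetric g g') ρ c dvg
              (Pi.single (Sum.inl b) 1) (Pi.single (Sum.inr d) 1)) := by
  have hG := fullMetric_isUnit_det hgu hgu'
  have hGs := fullMetric_isSymm hg hg'
  refine ⟨hQE.existsUnique_structureFunctions hG hGs, fun Q hQ => ?_, fun ψ => ?_,
    fun ρ c hs Q ψ hQ hψ => ⟨hQ.isEndTwo_curvature hQE.sq_zero,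
      hQ.hasInvariantTorsion_iff hg hg' hgu hgu' hs hψ, fun ht => ?_⟩⟩
  · obtain ⟨ψ, hψ⟩ := hQ.exists_coefficients
    exact ⟨ψ, hψ, fun ψ' hψ' => HasCoefficients.unique hψ' hψ⟩
  · obtain ⟨ρ, c, hs⟩ := hQE.exists_structureFunctions hG hGs
    obtain ⟨Q, hQ, hψ⟩ := hs.exists_connection hQE.isVectorField ψ
    exact ⟨Q, ⟨hQ, hψ⟩, fun Q' h' => h'.1.ext hQ h'.2 hψ⟩
  · have hric := hQ.ricci_eq_ricciComponent hg hg' hgu hgu' hs hψ ht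
    refine ⟨hric, fun Q' ψ' hQ' hψ' ht' htr => ?_, ?_, fun dvg hd hlam => ?_⟩
    · rw [hric, hQ'.ricci_eq_ricciComponent hg hg' hgu hgu' hs hψ' ht', htr]
    -- The values on `V₋` are arbitrary and set to 0: `GRic` takes divergences of sections of `V₊`
    -- only.
    · obtain ⟨dvg, hd, h⟩ := exists_isDivergence ρ (Sum.elim (fun a => -traceCoeff ψ a) 0)
      exact ⟨dvg, hd, fun a => h (Sum.inl a)⟩
    · rw [hric]
      congr 1
      ext1 b; ext1 d
      exact (gRic_frame hg' hgu hgu' hs.antisymm_left hs.antisymm_right hd hlam b d).symm
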